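/- Write $s_0,s_1,s_2,\dots$ for the standard (length-lexicographic) enumeration of $\{0,1\}^*$. All logarithms are to base $2$. A pair $(A,B)$ of disjoint languages $A,B\subseteq\{0,1\}^*$ is identified with the sequence $T\in\{-1,0,1\}^{\infty}$ given by $T[n]=1$ if $s_n\in A$, $T[n]=-1$ if $s_n\in B$, and $T[n]=0$ otherwise; $(A,B)[0..n-1]$ denotes its prefix of length $n$. Let $\mathrm{disjNP}$ (resp. $\mathrm{disjEXP}$) be the class of disjoint pairs $(A,B)$ with $A,B\in\mathrm{NP}$ (resp. $A,B\in\mathrm{EXP}=\bigcup_k\mathrm{DTIME}(2^{n^k})$). A \emph{pair martingale} is a function $d:\{-1,0,1\}^*\to[0,\infty)$ with $d(w)=\frac14 d(w0)+\frac38 d(w1)+\frac38 d(w(-1))$ for all $w\in\{-1,0,1\}^*$. It \emph{succeeds} on $(A,B)$ if $\limsup_{n\to\infty} d((A,B)[0..n-1])=\infty$. It is \emph{$\mathrm{p}_2$-computable} if its values are rational and, for some $k\in\mathbb N$, $d(w)$ can be computed exactly from $w$ in time $O(2^{(\log |w|)^k})$. A class $X$ of disjoint pairs has \emph{measure $0$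 in $\mathrm{disjEXP}$}, written $\mu(X\mid\mathrm{disjEXP})=0$, if some $\mathrm{p}_2$-computable pair martingale succeeds on every pair in $X\cap\mathrm{disjEXP}$; otherwise we write $\mu(X\mid\mathrm{disjEXP})\neq0$. For $t:\mathbb N\to[0,\infty)$, a disjoint pair $(A,B)$ is \emph{$t(n)$-generic} if for every set $C\subseteq\{-1,0,1\}^*$ in $\mathrm{DTIME}(t(n))$ such that for infinitely many $n$ there is $i\in\{-1,0,1\}$ with $(A,B)[0..n-1]\,i\in C$, there is some $n$ with $(A,B)[0..n-1]\in C$. \textbf{Theorem.} If $\mu(\mathrm{disjNP}\mid\mathrm{disjEXP})\neq 0$, then for every $k\in\mathbb N$ the class $\mathrm{disjNP}$ contains a $2^{(\log n)^k}$-generic pair. -/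

import Mathlib

open Filter
open scoped NNReal ENNReal

namespace DisjointPairs

/-! ### Turing machines and time-bounded computation -/

/-- A deterministic multi-tape Turing machine with input alphabet `α` and output alphabet `β`.
It has finitely many two-way infinite read/write tapes, one of which initially holds the input,
and a one-way write-only output tape. In state `q`, reading the symbols `a`, the machine halts
if `δ q a = none`; otherwise it changes state, rewrites the scanned cell of every tape, moves each
head by at most one cell (`none` means that the head stays put), and writes at most one symbol on
the output tape. -/
structure TM (α β : Type) where
  /-- states -/
  State : Type
  /-- indices of the tapes -/
  Ix : Type
  /-- tape symbols; the blank symbol is `default` -/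
  Sym : Type
  [finState : Finite State]
  [finIx : Finite Ix]
  [finSym : Finite Sym]
  [blank : Inhabited Sym]
  /-- initial state -/
  start : State
  /-- the tape that holds the input -/
  inputIx : Ix
  /-- the input symbols are non-blank tape symbols -/
  inputSym : α ↪ Sym
  inputSym_ne : ∀ a, inputSym a ≠ default
  /-- transition function -/
  δ : State → (Ix → Sym) → Option (State × (Ix → Sym × Option Turing.Dir) × Option β)

attribute [instance] TM.finState TM.finIx TM.finSym TM.blank

namespace TM

/-- Configurations: the state, the contents and head positions of the tapes, and the word written
so far on the output tape. -/
structure Cfg {α β : Type} (M : TM α β) where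
  state : M.State
  tape : M.Ix → Turing.Tape M.Sym
  out : List β

/-- The initial configuration on input `x`: the head of the input tape scans the first symbol of
`x`, all other tapes are blank, and the output tape is empty. -/
noncomputable def init {α β : Type} (M : TM α β) (x : List α) : M.Cfg :=
  open Classical in
  { state := M.start
    tape := fun i => Turing.Tape.mk₁ (if i = M.inputIx then x.map M.inputSym else [])
    out := [] }

/-- Write a symbol in the scanned cell and then move the head. -/
def act {Γ : Type} [Inhabited Γ] (t : Turing.Tape Γ) (p : Γ × Option Turing.Dir) :
    Turing.Tape Γ :=
  match p.2 with
  | none => t.write p.1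
  | some dir => (t.write p.1).move dir

/-- The action prescribed by the transition function in a configuration. -/
def next {α β : Type} (M : TM α β) (c : M.Cfg) :
    Option (M.State × (M.Ix → M.Sym × Option Turing.Dir) × Option β) :=
  M.δ c.state (fun i => (c.tape i).head)

/-- One step of computation; a halting configuration is left unchanged. -/
def step {α β : Type} (M : TM α β) (c : M.Cfg) : M.Cfg :=
  match M.next c with
  | none => c
  | some (q, a, b) =>
    { state := q
      tape := fun i => act (c.tape i) (a i)
      out := c.out ++ b.toList }

/-- On input `x`, the machine halts after at most `T` steps, having written `y` on the
output tape. -/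
def HaltsWithin {α β : Type} (M : TM α β) (x : List α) (T : ℕ) (y : List β) : Prop :=
  M.next (M.step^[T] (M.init x)) = none ∧ (M.step^[T] (M.init x)).out = y

end TM

/-- The function `f` on words is computable by a Turing machine in time `O(t(n))`, where `n` is the
length of the input. (The additive constant only matters at the finitely many lengths where
a time bound such as `n ^ k` vanishes.) -/
def ComputableInTime {α β : Type} (t : ℕ → ℝ) (f : List α → List β) : Prop :=
  ∃ (M : TM α β) (c : ℕ), ∀ x : List α, ∃ T : ℕ,
    (T : ℝ) ≤ c * t x.length + c ∧ M.HaltsWithin x T (f x)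

/-- `DTIME t` is the class of languages over `α` that can be decided in time `O(t(n))`: the machine
outputs the single bit `true` on words in the language and `false` on all others. -/
def DTIME {α : Type} (t : ℕ → ℝ) : Set (Set (List α)) :=
  open Classical in
  {L | ComputableInTime t (fun x : List α => [decide (x ∈ L)])}

/-- The time bound `2 ^ ((log n) ^ k)`, with logarithm to base 2. -/
noncomputable def quasiPoly (k : ℕ) (n : ℕ) : ℝ :=
  (2 : ℝ) ^ ((Real.logb 2 (n : ℝ)) ^ k)

/-! ### Complexity classes -/

/-- Polynomial time. -/
def P {α : Type} : Set (Set (List α)) :=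
  {L | ∃ k : ℕ, L ∈ DTIME (fun n => (n : ℝ) ^ k)}

/-- Exponential time `⋃ₖ DTIME(2 ^ (n ^ k))`. -/
def EXP : Set (Set (List Bool)) :=
  {L | ∃ k : ℕ, L ∈ DTIME (fun n => (2 : ℝ) ^ (n ^ k))}

/-- The word `u#v`, with `none` as the separator `#`. -/
def joinWords (u v : List Bool) : List (Option Bool) :=
  u.map some ++ none :: v.map some

/-- Nondeterministic polynomial time, via witnesses of polynomial length and
polynomial-time verification. -/
def NP : Set (Set (List Bool)) :=
  {L | ∃ (p : Polynomial ℕ) (V : Set (List (Option Bool))), V ∈ P ∧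
    ∀ x : List Bool, x ∈ L ↔ ∃ y : List Bool, y.length ≤ p.eval x.length ∧ joinWords x y ∈ V}

/-! ### Disjoint pairs -/

/-- The `n`-th word `s n` in the standard (length-lexicographic) enumeration
`λ, 0, 1, 00, 01, 10, 11, 000, …` of the binary words: the binary expansion of `n + 1`, most
significant bit first, without its leading `1`. -/
def s (n : ℕ) : List Bool :=
  (n + 1).bits.dropLast.reverse

/-- A disjoint pair `(A, B)` of languages over `{0, 1}`. -/
structure DisjointPair where
  A : Set (List Bool)
  B : Set (List Bool)
  disj : Disjoint A B

/-- The pairs of disjoint NP languages. -/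
def disjNP : Set DisjointPair :=
  {Q | Q.A ∈ NP ∧ Q.B ∈ NP}

/-- The pairs of disjoint EXP languages. -/
def disjEXP : Set DisjointPair :=
  {Q | Q.A ∈ EXP ∧ Q.B ∈ EXP}

namespace DisjointPair

/-- The sequence over `{-1, 0, 1}` that codes a disjoint pair. -/
noncomputable def seq (Q : DisjointPair) (n : ℕ) : SignType :=
  open Classical in
  if s n ∈ Q.A then 1 else if s n ∈ Q.B then -1 else 0

/-- The prefix of length `n` of the sequence that codes a disjoint pair. -/
noncomputable def pre (Q : DisjointPair) (n : ℕ) : List SignType :=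
  (List.range n).map Q.seq

/-! ### Genericity -/

/-- The condition `C` is dense along the pair. -/
def DenseAlong (Q : DisjointPair) (C : Set (List SignType)) : Prop :=
  {n : ℕ | ∃ i : SignType, Q.pre n ++ [i] ∈ C}.Infinite

/-- The pair meets the condition `C`. -/
def Meets (Q : DisjointPair) (C : Set (List SignType)) : Prop :=
  ∃ n : ℕ, Q.pre n ∈ C

/-- The pair meets every condition in `DTIME(t(n))` that is dense along it. -/
def IsGeneric (t : ℕ → ℝ) (Q : DisjointPair) : Prop :=
  ∀ C : Set (List SignType), C ∈ DTIME t → Q.DenseAlong C → Q.Meets C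

end DisjointPair

/-! ### Resource-bounded measure on disjoint pairs -/

/-- Pair martingales. -/
def IsPairMartingale (d : List SignType → ℝ≥0) : Prop :=
  ∀ w : List SignType,
    d w = 1 / 4 * d (w ++ [0]) + 3 / 8 * d (w ++ [1]) + 3 / 8 * d (w ++ [-1])

/-- The martingale `d` succeeds on the pair: the limit superior of its values on the prefixes of
the pair is infinite. -/
def Succeeds (d : List SignType → ℝ≥0) (Q : DisjointPair) : Prop :=
  limsup (fun n : ℕ => (d (Q.pre n) : ℝ≥0∞)) atTop = ⊤

/-- The number with binary expansion `u`, least significant bit first. -/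
def binVal (u : List Bool) : ℕ :=
  u.foldr Nat.bit 0

/-- `d` is (exactly) computable in time `2 ^ ((log n) ^ O(1))`: its values are rational, and some
machine with this running time computes from `w` a numerator and a denominator of `d w` in binary
notation. -/
def IsP2Computable (d : List SignType → ℝ≥0) : Prop :=
  ∃ (k : ℕ) (num den : List SignType → List Bool),
    ComputableInTime (quasiPoly k) (fun w => joinWords (num w) (den w)) ∧
    ∀ w, binVal (den w) ≠ 0 ∧ d w = (binVal (num w) : ℝ≥0) / (binVal (den w) : ℝ≥0)

/-- The class `X` of pairs has p₂-measure 0. -/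
def HasP2MeasureZero (X : Set DisjointPair) : Prop :=
  ∃ d : List SignType → ℝ≥0, IsPairMartingale d ∧ IsP2Computable d ∧ ∀ Q ∈ X, Succeeds d Q

/-- The class `X` of pairs has measure 0 in disjEXP, i.e. `μ(X ∣ disjEXP) = 0`. -/
def HasMeasureZeroInDisjEXP (X : Set DisjointPair) : Prop :=
  HasP2MeasureZero (X ∩ disjEXP)

end DisjointPairs

namespace DisjointPairs

/-! Suppose that, for some `k`, no pair in `disjNP` is generic. Each such pair `Q` then comes with a
condition `C`, decidable within the time bound, that is dense along `Q` but never met. A gambler who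
can decide `C` profits from this by betting, whenever a one-symbol extension of the current prefix
lies in `C`, against the first such symbol. Since `Q` avoids `C`, that symbol never occurs: the
capital never falls, and at infinitely many places it grows by a factor of at least 5/4
(`four_le_factor`, `five_le_factor`, `succeeds_mart`).

The countably many strategies are added with weights 2^-(j+1). Strategy `j` stays idle until the
prefix has length `j`, so on a prefix of length n all strategies from n on have capital 1 and
together contribute exactly 2^-n. The infinite sum is therefore a finite expression with denominator
8^n (`mart`). It is an exact martingale (`isPairMartingale_mart`) and dominates a constant multiple
of each single strategy (`capital_le_mart`), so it succeeds on every pair in `disjNP`, contrary to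
the hypothesis.

Most of the work is to compute this martingale in quasi-polynomial time. Trees serve as descriptions
of machines with a clock constant; `clocked` runs a description on a universal simulator for a
bounded number of steps, and `exists_clocked` and `exists_treeOf` show that every condition in the
time class receives a number. A tree that describes no machine does no harm, because the strategies
are fair for any Boolean test.

Running times are handled by the predicate `QP`: computability by a stack machine on tree codes,
with quasi-polynomial bounds on both time and output size. It is closed under composition, pairing,
branching and folds with bounded accumulators (`QP.foldl_of_bound`), so programs are ordinary
functions and most of their analysis is left to `fun_prop`; `QP.computableInTime` leads back to
Turing machines. Natural numbers are unary there, hence the exponentially large values of the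
martingale are computed as bit lists of fixed width (`binVal_numerW`). -/

/-! ### Stack machines -/

/-- The registers of a stack machine; each holds a stack of symbols. -/
inductive Reg
  | main | inp | x | y | cnt
  deriving DecidableEq

instance : Finite Reg :=
  Finite.of_injective (fun r : Reg => match r with
    | .main => (0 : Fin 5) | .inp => 1 | .x => 2 | .y => 3 | .cnt => 4) (by
    intro a b; cases a <;> cases b <;> simp)

/-- The instructions of a stack machine. -/
inductive Op
  | nop
  | push (i : Reg) (a : SignType)
  | pop (i : Reg)
  | emit (b : Option Bool)

/-- The memory of a stack machine: its registers, and the output written so far. -/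
@[ext]
structure Mem where
  reg : Reg → List SignType
  out : List (Option Bool)

namespace Mem

/-- The memory with the given contents of the registers. -/
def of (m i x y c : List SignType) (o : List (Option Bool)) : Mem where
  reg r := match r with
    | .main => m
    | .inp => i
    | .x => x
    | .y => y
    | .cnt => c
  out := o

/-- The symbols on top of the stacks. -/
def tops (m : Mem) (r : Reg) : Option SignType := (m.reg r).head?

/-- Replace the contents of a register. -/
def set (m : Mem) (r : Reg) (l : List SignType) : Mem :=
  ⟨Function.update m.reg r l, m.out⟩

variable (m i x y c l : List SignType) (o : List (Option Bool))

@[simp] theorem reg_main : (of m i x y c o).reg .main = m := rfl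
@[simp] theorem reg_inp : (of m i x y c o).reg .inp = i := rfl
@[simp] theorem reg_x : (of m i x y c o).reg .x = x := rfl
@[simp] theorem reg_y : (of m i x y c o).reg .y = y := rfl
@[simp] theorem reg_cnt : (of m i x y c o).reg .cnt = c := rfl
@[simp] theorem out_of : (of m i x y c o).out = o := rfl

@[simp] theorem set_main : (of m i x y c o).set .main l = of l i x y c o := by
  ext1
  · funext r; cases r <;> simp [set]
  · rfl
@[simp] theorem set_inp : (of m i x y c o).set .inp l = of m l x y c o := by
  ext1
  · funext r; cases r <;> simp [set]
  · rfl
@[simp] theorem set_x : (of m i x y c o).set .x l = of m i l y c o := by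
  ext1
  · funext r; cases r <;> simp [set]
  · rfl
@[simp] theorem set_y : (of m i x y c o).set .y l = of m i x l c o := by
  ext1
  · funext r; cases r <;> simp [set]
  · rfl
@[simp] theorem set_cnt : (of m i x y c o).set .cnt l = of m i x y l o := by
  ext1
  · funext r; cases r <;> simp [set]
  · rfl

end Mem

/-- The effect of an instruction. -/
def Op.run : Op → Mem → Mem
  | nop, m => m
  | push i a, m => m.set i (a :: m.reg i)
  | pop i, m => m.set i (m.reg i).tail
  | emit b, m => ⟨m.reg, m.out ++ [b]⟩

@[simp] theorem Op.run_nop (m : Mem) : Op.nop.run m = m := rfl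
@[simp] theorem Op.run_push (m : Mem) (i a) :
    (Op.push i a).run m = m.set i (a :: m.reg i) := rfl
@[simp] theorem Op.run_pop (m : Mem) (i) : (Op.pop i).run m = m.set i (m.reg i).tail := rfl
@[simp] theorem Op.run_emit (m i x y c o b) :
    (Op.emit b).run (Mem.of m i x y c o) = Mem.of m i x y c (o ++ [b]) := rfl

/-- A stack machine. The transition function yields the next state, or `none` at the exit. -/
structure SM where
  State : Type
  [fin : Finite State]
  entry : State
  next : State → (Reg → Option SignType) → Option State × Op

attribute [instance] SM.fin

namespace SM

/-- Started in state `q` with memory `m`, the machine exits after `n` steps with memory `m'`. -/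
inductive Exec (M : SM) : M.State → Mem → ℕ → Mem → Prop
  | exit {q m op} (h : M.next q m.tops = (none, op)) : Exec M q m 1 (op.run m)
  | step {q m q' op n m'} (h : M.next q m.tops = (some q', op))
      (e : Exec M q' (op.run m) n m') : Exec M q m (n + 1) m'

/-- Started with memory `m`, the machine exits after at most `N` steps with memory `m'`. -/
def Runs (M : SM) (m : Mem) (N : ℕ) (m' : Mem) : Prop :=
  ∃ n ≤ N, M.Exec M.entry m n m'

theorem Runs.mono {M : SM} {m m' N N'} (h : M.Runs m N m') (hN : N ≤ N') : M.Runs m N' m' := by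
  obtain ⟨n, hn, e⟩ := h
  exact ⟨n, hn.trans hN, e⟩

/-! ### Control structures and their running times -/

/-- A single instruction. -/
def op (o : Op) : SM where
  State := Unit
  entry := ()
  next _ _ := (none, o)

theorem runs_op (o : Op) (m : Mem) : (op o).Runs m 1 (o.run m) :=
  ⟨1, le_rfl, .exit rfl⟩

/-- Sequential composition. -/
def seq (p q : SM) : SM where
  State := p.State ⊕ q.State
  entry := .inl p.entry
  next s t := match s with
    | .inl s => match p.next s t with
      | (some s', o) => (some (.inl s'), o)
      | (none, o) => (some (.inr q.entry), o)
    | .inr s => match q.next s t with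
      | (some s', o) => (some (.inr s'), o)
      | (none, o) => (none, o)

/-- The exit step of `p` is redirected to the entry of `q`, so the step counts add without overhead.
-/
theorem runs_seq {p q : SM} {m m' m'' N N'} (h : p.Runs m N m') (h' : q.Runs m' N' m'') :
    (seq p q).Runs m (N + N') m'' := by
  obtain ⟨n, hn, e⟩ := h
  obtain ⟨n', hn', e'⟩ := h'
  have key' : ∀ {s m n m'}, q.Exec s m n m' → (seq p q).Exec (.inr s) m n m' := by
    intro s m n m' e
    induction e with
    | exit h => exact .exit (by simp [seq, h])
    | step h _ ih => exact .step (by simp [seq, h]) ih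
  have key : ∀ {s m n m'}, p.Exec s m n m' → q.Exec q.entry m' n' m'' →
      (seq p q).Exec (.inl s) m (n + n') m'' := by
    intro s m n m' e e'
    induction e with
    | exit h => rw [add_comm]; exact .step (by simp [seq, h]) (key' e')
    | step h _ ih =>
      rw [add_right_comm]; exact .step (by simp [seq, h]) (ih e')
  exact ⟨_, by omega, key e e'⟩

/-- Branching on a top symbol. -/
def ite (i : Reg) (c : Option SignType → Bool) (p q : SM) : SM where
  State := Option (p.State ⊕ q.State)
  entry := none
  next s t := match s with
    | none => (some (some (if c (t i) then .inl p.entry else .inr q.entry)), .nop)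
    | some (.inl s) => match p.next s t with
      | (some s', o) => (some (some (.inl s')), o)
      | (none, o) => (none, o)
    | some (.inr s) => match q.next s t with
      | (some s', o) => (some (some (.inr s')), o)
      | (none, o) => (none, o)

theorem runs_ite_true {i c} {p q : SM} {m m' N} (hc : c (m.tops i) = true) (h : p.Runs m N m') :
    (ite i c p q).Runs m (N + 1) m' := by
  obtain ⟨n, hn, e⟩ := h
  have key : ∀ {s m n m'}, p.Exec s m n m' → (ite i c p q).Exec (some (.inl s)) m n m' := by
    intro s m n m' e
    induction e with
    | exit h => exact .exit (by simp [ite, h])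
    | step h _ ih => exact .step (by simp [ite, h]) ih
  exact ⟨n + 1, by omega, .step (op := .nop) (by simp [ite, hc]) (key e)⟩

theorem runs_ite_false {i c} {p q : SM} {m m' N} (hc : c (m.tops i) = false)
    (h : q.Runs m N m') : (ite i c p q).Runs m (N + 1) m' := by
  obtain ⟨n, hn, e⟩ := h
  have key : ∀ {s m n m'}, q.Exec s m n m' → (ite i c p q).Exec (some (.inr s)) m n m' := by
    intro s m n m' e
    induction e with
    | exit h => exact .exit (by simp [ite, h])
    | step h _ ih => exact .step (by simp [ite, h]) ih
  exact ⟨n + 1, by omega, .step (op := .nop) (by simp [ite, hc]) (key e)⟩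

/-- Repeat a machine while the top symbol of a register satisfies a condition. -/
def whl (i : Reg) (c : Option SignType → Bool) (p : SM) : SM where
  State := Option p.State
  entry := none
  next s t := match s with
    | none => if c (t i) then (some (some p.entry), .nop) else (none, .nop)
    | some s => match p.next s t with
      | (some s', o) => (some (some s'), o)
      | (none, o) => (some none, o)

theorem runs_whl_false {i c} {p : SM} {m} (hc : c (m.tops i) = false) :
    (whl i c p).Runs m 1 m :=
  ⟨1, le_rfl, .exit (op := .nop) (by simp [whl, hc])⟩

theorem runs_whl_true {i c} {p : SM} {m m' m'' N N'} (hc : c (m.tops i) = true)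
    (h : p.Runs m N m') (h' : (whl i c p).Runs m' N' m'') :
    (whl i c p).Runs m (N + N' + 1) m'' := by
  obtain ⟨n, hn, e⟩ := h
  obtain ⟨n', hn', e'⟩ := h'
  have key : ∀ {s m n m'}, p.Exec s m n m' → (whl i c p).Exec none m' n' m'' →
      (whl i c p).Exec (some s) m (n + n') m'' := by
    intro s m n m' e e'
    induction e with
    | exit h => rw [add_comm]; exact .step (by simp [whl, h]) e'
    | step h _ ih => rw [add_right_comm]; exact .step (by simp [whl, h]) (ih e')
  exact ⟨n + n' + 1, by omega, .step (op := .nop) (by simp [whl, hc]) (key e e')⟩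

/-! ### Stack machines as Turing machines -/

/-- The Turing machine that simulates a stack machine. Its states hold the next state of the stack
machine, and the symbol that is still to be written in a push. -/
def toTM (M : SM) : TM SignType (Option Bool) where
  State := Option M.State × Option (Reg × SignType)
  Ix := Reg
  Sym := Option SignType
  start := (some M.entry, none)
  inputIx := .inp
  inputSym := ⟨some, Option.some_injective _⟩
  inputSym_ne := by intro a; simp
  δ s t := match s with
    | (k, some (i, a)) =>
      some ((k, none), fun j => if j = i then (some a, none) else (t j, none), none)
    | (none, none) => none
    | (some q, none) => match M.next q t with
      | (k, .nop) => some ((k, none), fun j => (t j, none), none)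
      | (k, .push i a) => some ((k, some (i, a)),
          fun j => if j = i then (t j, some .left) else (t j, none), none)
      | (k, .pop i) => some ((k, none),
          fun j => if j = i then (none, some .right) else (t j, none), none)
      | (k, .emit b) => some ((k, none), fun j => (t j, none), some b)

/-- The tape that represents a stack. -/
def stackTape (l : List SignType) : Turing.Tape (Option SignType) :=
  Turing.Tape.mk₁ (l.map some)

theorem stackTape_head (l : List SignType) : (stackTape l).head = l.head? := by
  cases l <;> rfl

theorem stackTape_stay (l : List SignType) : TM.act (stackTape l) (l.head?, none) = stackTape l := by
  rw [← stackTape_head]; exact Turing.Tape.write_self _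

theorem stackTape_pop (l : List SignType) :
    TM.act (stackTape l) (none, some .right) = stackTape l.tail := by
  simp only [TM.act, stackTape, Turing.Tape.mk₁, Turing.Tape.mk₂, Turing.Tape.write_mk',
    Turing.Tape.move_right_mk', Turing.ListBlank.head_cons, Turing.ListBlank.tail_cons,
    Turing.ListBlank.tail_mk, List.map_tail]
  congr 1
  -- The erased cell joins the left half of the tape, which is blank already.
  exact Turing.ListBlank.cons_head_tail (Turing.ListBlank.mk [])

/-- A stack lies to the right of the head, with blanks on the left. Since a machine writes before it
moves, a push takes two steps: keep the old top and move left, then write the new symbol. -/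
theorem stackTape_push (l : List SignType) (a : SignType) :
    TM.act (TM.act (stackTape l) (l.head?, some .left)) (some a, none) = stackTape (a :: l) := by
  have h : TM.act (stackTape l) (l.head?, some .left) = (stackTape l).move .left := by
    rw [← stackTape_head]
    simp only [TM.act, Turing.Tape.write_self]
  rw [h]
  simp only [TM.act, stackTape, Turing.Tape.mk₁, Turing.Tape.mk₂, Turing.Tape.write_mk',
    Turing.Tape.move_left_mk', Turing.ListBlank.cons_mk, List.map_cons]
  rfl

/-- The configuration of the Turing machine that represents a configuration of `M`. -/
def cfg (M : SM) (k : Option M.State) (m : Mem) : M.toTM.Cfg where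
  state := (k, none)
  tape i := stackTape (m.reg i)
  out := m.out

theorem cfg_heads (M : SM) (k m) : (fun i => ((M.cfg k m).tape i).head) = m.tops :=
  funext fun _ => stackTape_head _

theorem toTM_step (M : SM) {q m k o} (h : M.next q m.tops = (k, o)) :
    ∃ n, n ≤ 2 ∧ M.toTM.step^[n] (M.cfg (some q) m) = M.cfg k (o.run m) := by
  have hn : M.toTM.next (M.cfg (some q) m) = M.toTM.δ (some q, none) m.tops := by
    rw [← cfg_heads M (some q) m]; rfl
  cases o with
  | nop =>
    refine ⟨1, by simp, ?_⟩
    rw [Function.iterate_one, TM.step, hn]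
    simp only [toTM, h, cfg, Option.toList_none, List.append_nil, Op.run_nop]
    congr 1
    funext i
    exact stackTape_stay _
  | emit b =>
    refine ⟨1, by simp, ?_⟩
    rw [Function.iterate_one, TM.step, hn]
    simp only [toTM, h, cfg, Option.toList_some, Op.run]
    congr 1
    funext i
    exact stackTape_stay _
  | pop j =>
    refine ⟨1, by simp, ?_⟩
    rw [Function.iterate_one, TM.step, hn]
    simp only [toTM, h, cfg, Option.toList_none, List.append_nil, Op.run_pop, Mem.set]
    congr 1
    funext i
    by_cases hi : i = j
    · subst hi; simp only [if_true, Function.update_self]; exact stackTape_pop _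
    · simp only [hi, if_false, Function.update_of_ne, Ne, not_false_eq_true]
      exact stackTape_stay _
  | push j a =>
    refine ⟨2, le_rfl, ?_⟩
    have h1 : M.toTM.step (M.cfg (some q) m) =
        { state := (k, some (j, a))
          tape := fun i : Reg => TM.act (stackTape (m.reg i))
            (if i = j then (m.tops i, some .left) else (m.tops i, none))
          out := m.out } := by
      rw [TM.step, hn]
      simp only [toTM, h, cfg, Option.toList_none, List.append_nil]
    rw [Function.iterate_succ_apply', Function.iterate_one, h1]
    simp only [TM.step, TM.next, toTM, cfg, Option.toList_none, List.append_nil, Op.run_push,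
      Mem.set]
    congr 1
    funext i
    by_cases hi : i = j
    · subst hi
      simp only [if_true, Function.update_self]
      exact stackTape_push _ _
    · simp only [hi, if_false, Function.update_of_ne, Ne, not_false_eq_true, Mem.tops]
      -- The other tapes are rewritten unchanged in both steps of the push.
      refine (congrArg (fun t => TM.act t (t.head, none)) (stackTape_stay _)).trans ?_
      rw [stackTape_head, stackTape_stay]

theorem Exec.toTM {M : SM} {q m n m'} (e : M.Exec q m n m') :
    ∃ T ≤ 2 * n, M.toTM.step^[T] (M.cfg (some q) m) = M.cfg none m' := by
  induction e with
  | exit h =>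
    obtain ⟨t, ht, e⟩ := M.toTM_step h
    exact ⟨t, ht, e⟩
  | step h _ ih =>
    obtain ⟨t, ht, e⟩ := M.toTM_step h
    obtain ⟨T, hT, E⟩ := ih
    exact ⟨T + t, by omega, by rw [Function.iterate_add_apply, e, E]⟩

theorem toTM_init (M : SM) (w : List SignType) :
    M.toTM.init w = M.cfg (some M.entry) (Mem.of [] w [] [] [] []) := by
  simp only [TM.init, cfg, Mem.out_of]
  congr 1
  funext i
  cases i <;> simp [toTM, stackTape, Mem.of] <;> rfl

/-- A stack machine that reads its input from the register `inp` yields a Turing machine. -/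
theorem Runs.haltsWithin {M : SM} {w N m'}
    (h : M.Runs (Mem.of [] w [] [] [] []) N m') :
    ∃ T ≤ 2 * N, M.toTM.HaltsWithin w T m'.out := by
  obtain ⟨n, hn, e⟩ := h
  obtain ⟨T, hT, E⟩ := e.toTM
  refine ⟨T, by omega, ?_⟩
  rw [TM.HaltsWithin, toTM_init, E]
  exact ⟨rfl, rfl⟩

end SM

/-! ### Quasi-polynomial bounds -/

/-- The standard quasi-polynomial bounds. -/
def qb (k n : ℕ) : ℕ := 2 ^ ((n.size + k) ^ k)

/-- `B` is bounded by a quasi-polynomial. -/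
def QB (B : ℕ → ℕ) : Prop := ∃ k, ∀ n, B n ≤ qb k n

theorem qb_pos (k n : ℕ) : 0 < qb k n := Nat.two_pow_pos _

theorem qb_mono (k : ℕ) : Monotone (qb k) := fun _ _ h =>
  Nat.pow_le_pow_right (by norm_num)
    (Nat.pow_le_pow_left (Nat.add_le_add_right (Nat.size_le_size h) k) k)

theorem add_pow_self_mono (s : ℕ) {j k : ℕ} (h : j ≤ k) : (s + j) ^ j ≤ (s + k) ^ k := by
  rcases Nat.eq_zero_or_pos k with rfl | hk
  · obtain rfl : j = 0 := by omega
    rfl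
  · exact (Nat.pow_le_pow_left (by omega) j).trans (Nat.pow_le_pow_right (by omega) h)

theorem qb_mono_left (n : ℕ) {j k : ℕ} (h : j ≤ k) : qb j n ≤ qb k n :=
  Nat.pow_le_pow_right (by norm_num) (add_pow_self_mono _ h)

namespace QB

theorem qb (k : ℕ) : QB (qb k) := ⟨k, fun _ => le_rfl⟩

theorem mono {B B' : ℕ → ℕ} (h : QB B') (hB : ∀ n, B n ≤ B' n) : QB B :=
  h.imp fun _ hk n => (hB n).trans (hk n)

theorem id : QB fun n => n :=
  ⟨1, fun n => by
    have := Nat.lt_size_self n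
    change n ≤ 2 ^ ((n.size + 1) ^ 1)
    rw [pow_one, pow_succ]
    omega⟩

theorem const (c : ℕ) : QB fun _ => c := by
  refine ⟨c + 1, fun n => Nat.lt_two_pow_self.le.trans (Nat.pow_le_pow_right (by norm_num) ?_)⟩
  calc c ≤ (n.size + (c + 1)) ^ 1 := by rw [pow_one]; omega
    _ ≤ _ := Nat.pow_le_pow_right (by omega) (by omega)

theorem mul {B B' : ℕ → ℕ} (h : QB B) (h' : QB B') : QB fun n => B n * B' n := by
  obtain ⟨i, hi⟩ := h
  obtain ⟨j, hj⟩ := h'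
  -- The exponents add up to at most twice the larger one; the increase by 2 makes the base at least
  -- 2 and leaves room for one more factor.
  refine ⟨max i j + 2, fun n => (Nat.mul_le_mul (hi n) (hj n)).trans ?_⟩
  rw [DisjointPairs.qb, DisjointPairs.qb, DisjointPairs.qb, ← pow_add]
  refine Nat.pow_le_pow_right (by norm_num) ?_
  have h1 := add_pow_self_mono n.size (le_max_left i j)
  have h2 := add_pow_self_mono n.size (le_max_right i j)
  set m := max i j
  have h3 : (n.size + m) ^ m ≤ (n.size + (m + 2)) ^ m := Nat.pow_le_pow_left (by omega) m
  calc _ ≤ (n.size + (m + 2)) ^ m * 2 := by omega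
    _ ≤ (n.size + (m + 2)) ^ m * (n.size + (m + 2)) := Nat.mul_le_mul_left _ (by omega)
    _ ≤ _ := by rw [← pow_succ]; exact Nat.pow_le_pow_right (by omega) (by omega)

theorem add {B B' : ℕ → ℕ} (h : QB B) (h' : QB B') : QB fun n => B n + B' n := by
  obtain ⟨i, hi⟩ := h
  obtain ⟨j, hj⟩ := h'
  -- Both bounds are at least 1, so their sum is at most twice their product.
  refine (((qb i).mul (qb j)).mul (const 2)).mono fun n => ?_
  have h1 := hi n
  have h2 := hj n
  have h3 := Nat.mul_le_mul_left (DisjointPairs.qb i n) (qb_pos j n)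
  have h4 := Nat.mul_le_mul_right (DisjointPairs.qb j n) (qb_pos i n)
  simp only [Nat.succ_eq_add_one, zero_add, mul_one, one_mul] at h3 h4
  omega

/-- The inner bound is a power of 2, so its binary length is its exponent plus 1, a polynomial in
`n.size`. The outer bound then has as its exponent a polynomial of a polynomial. -/
theorem comp {B B' : ℕ → ℕ} (h : QB B) (h' : QB B') : QB fun n => B (B' n) := by
  obtain ⟨i, hi⟩ := h
  obtain ⟨j, hj⟩ := h'
  refine ⟨max (i + j + 2) ((j + 1) * i), fun n =>
    (hi _).trans ((qb_mono i (hj n)).trans ?_)⟩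
  have hs : (DisjointPairs.qb j n).size = (n.size + j) ^ j + 1 := Nat.size_pow
  rw [DisjointPairs.qb, hs, DisjointPairs.qb]
  refine Nat.pow_le_pow_right (by norm_num) ?_
  set m := i + j + 2
  have h0 : (n.size + j) ^ j ≤ (n.size + m) ^ j := Nat.pow_le_pow_left (by omega) j
  have h1 : 1 ≤ (n.size + m) ^ j := Nat.one_le_pow _ _ (by omega)
  have h2 : (n.size + j) ^ j + 1 + i ≤ (n.size + m) ^ (j + 1) := by
    calc _ ≤ (n.size + m) ^ j + (n.size + m) ^ j * (1 + i) := by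
            have := Nat.mul_le_mul_right (1 + i) h1
            omega
      _ = (n.size + m) ^ j * (2 + i) := by ring
      _ ≤ _ := by rw [pow_succ]; exact Nat.mul_le_mul_left _ (by omega)
  calc _ ≤ ((n.size + m) ^ (j + 1)) ^ i := Nat.pow_le_pow_left h2 i
    _ = (n.size + m) ^ ((j + 1) * i) := (pow_mul _ _ _).symm
    _ ≤ (n.size + max m ((j + 1) * i)) ^ ((j + 1) * i) := Nat.pow_le_pow_left (by omega) _
    _ ≤ _ := Nat.pow_le_pow_right (by omega) (le_max_right _ _)

end QB

/-! ### Trees on a stack -/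

/-- Binary trees. -/
inductive Tr
  | nil
  | node (l r : Tr)

namespace Tr

/-- The prefix code of a tree. -/
def code : Tr → List SignType
  | nil => [0]
  | node l r => 1 :: (l.code ++ r.code)

/-- The number of nodes of a tree, including its leaves. -/
def size : Tr → ℕ
  | nil => 1
  | node l r => l.size + r.size + 1

@[simp] theorem size_nil : nil.size = 1 := rfl
@[simp] theorem size_node (l r : Tr) : (node l r).size = l.size + r.size + 1 := rfl

@[simp] theorem length_code : ∀ t : Tr, t.code.length = t.size
  | nil => rfl
  | node l r => by simp [code, length_code l, length_code r]

theorem size_pos (t : Tr) : 0 < t.size := by cases t <;> simp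

/-- The left subtree. -/
def left : Tr → Tr
  | nil => nil
  | node l _ => l

/-- The right subtree. -/
def right : Tr → Tr
  | nil => nil
  | node _ r => r

/-- Is the tree different from `nil`? -/
def isNode : Tr → Bool
  | nil => false
  | node _ _ => true

theorem size_left_le (t : Tr) : t.left.size ≤ t.size := by
  cases t <;> simp [left]; omega

theorem size_right_le (t : Tr) : t.right.size ≤ t.size := by
  cases t <;> simp [right]; omega

theorem size_left_add_size_right_le (t : Tr) : t.left.size + t.right.size ≤ t.size + 1 := by
  cases t <;> simp [left, right]; omega

end Tr

namespace SM

/-- The memory in which only `main` and `inp` are in use. -/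
abbrev stk (m i : List SignType) (o : List (Option Bool)) : Mem := Mem.of m i [] [] [] o

/-- Branching on the symbol on top of a nonempty register. -/
def branch (i : Reg) (f : SignType → SM) : SM :=
  ite i (fun a => a = some 0) (f 0) (ite i (fun a => a = some 1) (f 1) (f (-1)))

theorem runs_branch {i f} {m m' : Mem} {N} (a : SignType) (ha : m.tops i = some a)
    (h : (f a).Runs m N m') : (branch i f).Runs m (N + 2) m' := by
  cases a
  · exact (runs_ite_true (by simp [ha]) h).mono (by omega)
  · exact runs_ite_false (by simp [ha]) (runs_ite_false (by simp [ha]) h)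
  · exact runs_ite_false (by simp [ha]) (runs_ite_true (by simp [ha]) h)

/-! ### Moving words and tree codes between registers -/

/-- Move the symbols of `src` to `dst`, which reverses their order. -/
def move (src dst : Reg) : SM :=
  whl src Option.isSome (branch src fun a => seq (op (.pop src)) (op (.push dst a)))

section
variable (r i x y c : List SignType) (o : List (Option Bool))

theorem runs_move_x_main (l : List SignType) : (move .x .main).Runs (Mem.of r i l y c o)
    (5 * l.length + 1) (Mem.of (l.reverse ++ r) i [] y c o) := by
  induction l generalizing r with
  | nil => exact runs_whl_false rfl
  | cons a l ih =>
    refine (runs_whl_true rfl (runs_branch a rfl (runs_seq (runs_op _ _) (runs_op _ _)))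
      (by simpa [move] using ih (a :: r))).mono ?_
    simp; omega

theorem runs_move_y_main (l : List SignType) : (move .y .main).Runs (Mem.of r i x l c o)
    (5 * l.length + 1) (Mem.of (l.reverse ++ r) i x [] c o) := by
  induction l generalizing r with
  | nil => exact runs_whl_false rfl
  | cons a l ih =>
    refine (runs_whl_true rfl (runs_branch a rfl (runs_seq (runs_op _ _) (runs_op _ _)))
      (by simpa [move] using ih (a :: r))).mono ?_
    simp; omega

theorem runs_move_y_x (l : List SignType) : (move .y .x).Runs (Mem.of r i x l c o)
    (5 * l.length + 1) (Mem.of r i (l.reverse ++ x) [] c o) := by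
  induction l generalizing x with
  | nil => exact runs_whl_false rfl
  | cons a l ih =>
    refine (runs_whl_true rfl (runs_branch a rfl (runs_seq (runs_op _ _) (runs_op _ _)))
      (by simpa [move] using ih (a :: x))).mono ?_
    simp; omega

/-- Move the symbols of `x` to both `main` and `y`. -/
def fork : SM :=
  whl .x Option.isSome (branch .x fun a =>
    seq (op (.pop .x)) (seq (op (.push .main a)) (op (.push .y a))))

theorem runs_fork (l : List SignType) : fork.Runs (Mem.of r i l y c o)
    (6 * l.length + 1) (Mem.of (l.reverse ++ r) i [] (l.reverse ++ y) c o) := by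
  induction l generalizing r y with
  | nil => exact runs_whl_false rfl
  | cons a l ih =>
    refine (runs_whl_true rfl (runs_branch a rfl
      (runs_seq (runs_op _ _) (runs_seq (runs_op _ _) (runs_op _ _))))
      (by simpa [fork] using ih (a :: r) (a :: y))).mono ?_
    simp; omega

/-- Empty the register `x`. -/
def clear : SM := whl .x Option.isSome (op (.pop .x))

theorem runs_clear (l : List SignType) : clear.Runs (Mem.of r i l y c o)
    (2 * l.length + 1) (Mem.of r i [] y c o) := by
  induction l with
  | nil => exact runs_whl_false rfl
  | cons a l ih =>
    refine (runs_whl_true rfl (runs_op _ _) (by simpa [clear] using ih)).mono ?_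
    simp; omega

/-- The loop that moves as many tree codes from `main` to `dst` as there are symbols in `cnt`. -/
def readLoop (dst : Reg) : SM :=
  whl .cnt Option.isSome (ite .main (fun a => a = some 1)
    (seq (op (.pop .main)) (seq (op (.push dst 1)) (op (.push .cnt 1))))
    (seq (op (.pop .main)) (seq (op (.push dst 0)) (op (.pop .cnt)))))

variable {r i x y c o}

/-- The register `cnt` counts the trees still to be read: a leaf settles one, a node replaces one by
two. The claim is relative to an arbitrary continuation of the loop, so that the induction
hypotheses for the two subtrees can be chained. -/
theorem runs_readLoop_x (t : Tr) {N m'}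
    (h : (readLoop .x).Runs (Mem.of r i (t.code.reverse ++ x) y c o) N m') :
    (readLoop .x).Runs (Mem.of (t.code ++ r) i x y (1 :: c) o) (N + 5 * t.size) m' := by
  induction t generalizing r x c N m' with
  | nil =>
    refine (runs_whl_true rfl (runs_ite_false (by simp [Tr.code, Mem.tops])
      (runs_seq (runs_op _ _) (runs_seq (runs_op _ _) (runs_op _ _))))
      (by simpa [Tr.code, readLoop] using h)).mono ?_
    simp; omega
  | node a b iha ihb =>
    refine (runs_whl_true rfl (runs_ite_true (by simp [Tr.code, Mem.tops])
      (runs_seq (runs_op _ _) (runs_seq (runs_op _ _) (runs_op _ _)))) (N' := _)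
      (by simpa [Tr.code, readLoop] using iha (ihb (by simpa [Tr.code] using h)))).mono ?_
    simp; omega

theorem runs_readLoop_y (t : Tr) {N m'}
    (h : (readLoop .y).Runs (Mem.of r i x (t.code.reverse ++ y) c o) N m') :
    (readLoop .y).Runs (Mem.of (t.code ++ r) i x y (1 :: c) o) (N + 5 * t.size) m' := by
  induction t generalizing r y c N m' with
  | nil =>
    refine (runs_whl_true rfl (runs_ite_false (by simp [Tr.code, Mem.tops])
      (runs_seq (runs_op _ _) (runs_seq (runs_op _ _) (runs_op _ _))))
      (by simpa [Tr.code, readLoop] using h)).mono ?_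
    simp; omega
  | node a b iha ihb =>
    refine (runs_whl_true rfl (runs_ite_true (by simp [Tr.code, Mem.tops])
      (runs_seq (runs_op _ _) (runs_seq (runs_op _ _) (runs_op _ _)))) (N' := _)
      (by simpa [Tr.code, readLoop] using iha (ihb (by simpa [Tr.code] using h)))).mono ?_
    simp; omega

/-- Move one tree code from `main` to `dst`. -/
def read (dst : Reg) : SM := seq (op (.push .cnt 1)) (readLoop dst)

theorem runs_read_x (t : Tr) : (read .x).Runs (Mem.of (t.code ++ r) i x y [] o)
    (5 * t.size + 2) (Mem.of r i (t.code.reverse ++ x) y [] o) := by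
  refine (runs_seq (runs_op _ _) (N' := 1 + 5 * t.size) ?_).mono (by omega)
  simpa using runs_readLoop_x t (runs_whl_false rfl)

theorem runs_read_y (t : Tr) : (read .y).Runs (Mem.of (t.code ++ r) i x y [] o)
    (5 * t.size + 2) (Mem.of r i x (t.code.reverse ++ y) [] o) := by
  refine (runs_seq (runs_op _ _) (N' := 1 + 5 * t.size) ?_).mono (by omega)
  simpa using runs_readLoop_y t (runs_whl_false rfl)

/-- Remove the tree on top of the stack. -/
def drop : SM := seq (read .x) clear

theorem runs_drop (t : Tr) : drop.Runs (stk (t.code ++ r) i o) (7 * t.size + 3) (stk r i o) := by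
  refine (runs_seq (runs_read_x t) (runs_clear _ _ _ _ _ _)).mono ?_
  simp; omega

/-- Duplicate the tree on top of the stack. -/
def dup : SM := seq (read .x) (seq fork (seq (move .y .x) (move .x .main)))

/-- Every transfer reverses the word. The copy in `y` therefore passes through `x` to reach `main`
in its original order. -/
theorem runs_dup (t : Tr) :
    dup.Runs (stk (t.code ++ r) i o) (21 * t.size + 5) (stk (t.code ++ (t.code ++ r)) i o) := by
  refine (runs_seq (runs_read_x t) (runs_seq (runs_fork _ _ _ _ _ _)
    (runs_seq (runs_move_y_x _ _ _ _ _ _)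
      (N' := 5 * t.size + 1) ?_))).mono (N := _) ?_
  · simpa using runs_move_x_main (t.code ++ r) i [] [] o t.code.reverse
  · simp; omega

/-- Exchange the two trees on top of the stack. -/
def swap : SM := seq (read .x) (seq (read .y) (seq (move .x .main) (move .y .main)))

theorem runs_swap (s t : Tr) : swap.Runs (stk (s.code ++ (t.code ++ r)) i o)
    (10 * s.size + 10 * t.size + 6) (stk (t.code ++ (s.code ++ r)) i o) := by
  refine (runs_seq (runs_read_x s) (runs_seq (runs_read_y t)
    (runs_seq (runs_move_x_main _ _ _ _ _ _)
      (N' := 5 * t.size + 1) ?_))).mono (N := _) ?_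
  · simpa using runs_move_y_main (s.code ++ r) i [] [] o t.code.reverse
  · simp; omega

/-- Push a word. -/
def pushAll : List SignType → SM
  | [] => op .nop
  | a :: l => seq (pushAll l) (op (.push .main a))

theorem runs_pushAll (l : List SignType) :
    (pushAll l).Runs (stk r i o) (l.length + 1) (stk (l ++ r) i o) := by
  induction l with
  | nil => exact runs_op _ _
  | cons a l ih => simpa [pushAll] using runs_seq ih (runs_op (.push .main a) _)

end

/-! ### Operations on the tree on top of the stack -/

/-- The machine replaces the tree `s` on top of the stack by `t` within `N` steps. -/
def Maps (p : SM) (s t : Tr) (N : ℕ) : Prop :=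
  ∀ r i o, p.Runs (stk (s.code ++ r) i o) N (stk (t.code ++ r) i o)

theorem Maps.mono {p : SM} {s t N N'} (h : p.Maps s t N) (hN : N ≤ N') : p.Maps s t N' :=
  fun r i o => (h r i o).mono hN

theorem Maps.seq {p q : SM} {s t u N N'} (h : p.Maps s t N) (h' : q.Maps t u N') :
    (seq p q).Maps s u (N + N') :=
  fun r i o => runs_seq (h r i o) (h' r i o)

/-- Pair the results of two machines. -/
def mkPair (p q : SM) : SM := SM.seq dup (SM.seq q (SM.seq swap (SM.seq p (op (.push .main 1)))))

/-- In the prefix code of a pair the second component lies deeper in the stack. Hence `q` is run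
first, and a final 1 on top completes the node. -/
theorem Maps.mkPair {p q : SM} {s t u N N'} (h : p.Maps s t N) (h' : q.Maps s u N') :
    (mkPair p q).Maps s (.node t u) (N + N' + 31 * s.size + 10 * u.size + 12) := by
  intro r i o
  refine (runs_seq (runs_dup s) (runs_seq (h' _ _ _) (runs_seq (runs_swap u s)
    (runs_seq (h _ _ _) (N' := 1) ?_)))).mono (by omega)
  simpa [Tr.code] using runs_op (.push .main 1) (stk (t.code ++ (u.code ++ r)) i o)

/-- Replace a pair by its first component. -/
def first : SM := SM.seq (op (.pop .main)) (SM.seq swap drop)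

theorem maps_first (s t : Tr) : first.Maps (.node s t) s (10 * s.size + 17 * t.size + 10) := by
  intro r i o
  refine (runs_seq (runs_op _ _) (runs_seq (N := _) (m' := stk (t.code ++ (s.code ++ r)) i o) ?_
    (runs_drop t))).mono (N := 1 + ((10 * s.size + 10 * t.size + 6) + (7 * t.size + 3))) (by omega)
  simpa [Tr.code] using runs_swap s t

/-- Replace a pair by its second component. -/
def second : SM := SM.seq (op (.pop .main)) drop

theorem maps_second (s t : Tr) : second.Maps (.node s t) t (7 * s.size + 4) := by
  intro r i o
  refine (runs_seq (runs_op _ _) (N' := 7 * s.size + 3) ?_).mono (by omega)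
  simpa [Tr.code] using runs_drop s

/-- Run a machine only on trees other than `nil`. -/
def onNode (p : SM) : SM := ite .main (fun a => a = some 1) p (op .nop)

theorem maps_onNode_nil (p : SM) : (onNode p).Maps .nil .nil 2 :=
  fun _ _ _ => runs_ite_false (by simp [Tr.code, Mem.tops]) (runs_op _ _)

theorem Maps.onNode {p : SM} {s t u N} (h : p.Maps (.node s t) u N) :
    (onNode p).Maps (.node s t) u (N + 1) :=
  fun _ _ _ => runs_ite_true (by simp [Tr.code, Mem.tops]) (h _ _ _)

/-- Replace a tree by a fixed tree. -/
def constant (t : Tr) : SM := SM.seq drop (pushAll t.code)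

theorem maps_constant (s t : Tr) : (constant t).Maps s t (7 * s.size + t.size + 4) :=
  fun _ _ _ => (runs_seq (runs_drop s) (runs_pushAll _)).mono (by simp; omega)

/-- Branch on the result of a test. -/
def cond (c p q : SM) : SM :=
  SM.seq dup (SM.seq c (ite .main (fun a => a = some 1) (SM.seq drop p) (SM.seq drop q)))

theorem Maps.cond_true {c p q : SM} {s a b t N N'} (hc : c.Maps s (.node a b) N)
    (h : p.Maps s t N') :
    (cond c p q).Maps s t (N + N' + 21 * s.size + 7 * (Tr.node a b).size + 9) := by
  intro r i o
  exact (runs_seq (runs_dup s) (runs_seq (hc _ _ _) (runs_ite_true (by simp [Tr.code, Mem.tops])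
    (runs_seq (runs_drop _) (h _ _ _))))).mono (by omega)

theorem Maps.cond_false {c p q : SM} {s t N N'} (hc : c.Maps s .nil N)
    (h : q.Maps s t N') : (cond c p q).Maps s t (N + N' + 21 * s.size + 16) := by
  intro r i o
  exact (runs_seq (runs_dup s) (runs_seq (hc _ _ _) (runs_ite_false (by simp [Tr.code, Mem.tops])
    (runs_seq (runs_drop _) (h _ _ _))))).mono (by simp; omega)

/-- Repeat a machine as long as the first component of the pair on top of the stack is not
`nil`. -/
def loop (p : SM) : SM :=
  SM.seq (op (.pop .main)) (SM.seq
    (whl .main (fun a => a = some 1)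
      (SM.seq (op (.push .main 1)) (SM.seq p (op (.pop .main)))))
    (op (.push .main 1)))

end SM

/-! ### Data represented by trees -/

/-- Types whose elements are represented by trees. -/
class TreeRep (α : Type) where
  toT : α → Tr

open TreeRep (toT)

instance : TreeRep Tr := ⟨id⟩
instance : TreeRep Unit := ⟨fun _ => .nil⟩
instance : TreeRep Bool := ⟨fun b => if b then .node .nil .nil else .nil⟩
instance : TreeRep ℕ := ⟨Nat.rec .nil fun _ t => .node .nil t⟩
instance {α β : Type} [TreeRep α] [TreeRep β] : TreeRep (α × β) := ⟨fun x => .node (toT x.1) (toT x.2)⟩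
instance {α : Type} [TreeRep α] : TreeRep (List α) := ⟨List.foldr (fun a t => .node (toT a) t) .nil⟩

/-- The size of the representation. -/
def sz {α : Type} [TreeRep α] (a : α) : ℕ := (toT a).size

section

variable {α β γ δ σ : Type} [TreeRep α] [TreeRep β] [TreeRep γ] [TreeRep δ] [TreeRep σ]

@[simp] theorem toT_tr (t : Tr) : toT t = t := rfl
@[simp] theorem toT_unit (t : Unit) : toT t = .nil := rfl
@[simp] theorem toT_true : toT true = .node .nil .nil := rfl
@[simp] theorem toT_false : toT false = .nil := rfl
@[simp] theorem toT_pair (a : α) (b : β) : toT (a, b) = .node (toT a) (toT b) := rfl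
@[simp] theorem toT_nil : toT ([] : List α) = .nil := rfl
@[simp] theorem toT_cons (a : α) (l : List α) : toT (a :: l) = .node (toT a) (toT l) := rfl
@[simp] theorem toT_zero : toT 0 = .nil := rfl
@[simp] theorem toT_succ (n : ℕ) : toT (n + 1) = .node .nil (toT n) := rfl

theorem sz_pos (a : α) : 0 < sz a := Tr.size_pos _
theorem sz_tr (t : Tr) : sz t = t.size := rfl
@[simp] theorem sz_unit (t : Unit) : sz t = 1 := rfl
theorem sz_bool_le (b : Bool) : sz b ≤ 3 := by cases b <;> simp [sz]
theorem sz_mk (a : α) (b : β) : sz (a, b) = sz a + sz b + 1 := rfl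
theorem sz_prod (x : α × β) : sz x = sz x.1 + sz x.2 + 1 := rfl
@[simp] theorem sz_nil : sz ([] : List α) = 1 := rfl
@[simp] theorem sz_cons (a : α) (l : List α) : sz (a :: l) = sz a + sz l + 1 := rfl
@[simp] theorem sz_nat (n : ℕ) : sz n = 2 * n + 1 := by
  induction n with
  | zero => rfl
  | succ n ih => simp only [sz, toT_succ, Tr.size_node, Tr.size_nil] at ih ⊢; omega

theorem sz_append (l l' : List α) : sz (l ++ l') + 1 = sz l + sz l' := by
  induction l with
  | nil => simp; omega
  | cons a l ih => simp only [List.cons_append, sz_cons]; omega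

theorem sz_reverse (l : List α) : sz l.reverse = sz l := by
  induction l with
  | nil => rfl
  | cons a l ih =>
    have := sz_append l.reverse [a]
    simp only [List.reverse_cons, sz_cons, sz_nil] at this ⊢; omega

theorem length_lt_sz (l : List α) : l.length < sz l := by
  induction l with
  | nil => simp
  | cons a l ih => simp only [List.length_cons, sz_cons]; omega

theorem sz_lt_of_mem {a : α} {l : List α} (h : a ∈ l) : sz a < sz l := by
  induction l with
  | nil => simp at h
  | cons b l ih =>
    rw [sz_cons]
    rcases List.mem_cons.1 h with rfl | h
    · have := sz_pos l; omega
    · have := ih h; omega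

theorem sz_list_le {l : List α} {c : ℕ} (h : ∀ a ∈ l, sz a ≤ c) :
    sz l ≤ (c + 1) * l.length + 1 := by
  induction l with
  | nil => simp
  | cons a l ih =>
    have h1 := ih fun b hb => h b (by simp [hb])
    have h2 := h a (by simp)
    simp only [sz_cons, List.length_cons, mul_add]; omega

/-! ### Functions computable in quasi-polynomial time -/

/-- The function `f` can be computed on a stack machine in quasi-polynomial time. -/
@[fun_prop]
def QP (f : α → β) : Prop :=
  ∃ (p : SM) (k : ℕ), ∀ a, p.Maps (toT a) (toT (f a)) (qb k (sz a)) ∧ sz (f a) ≤ qb k (sz a)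

namespace QP

theorem of_maps {f : α → β} {B B' : ℕ → ℕ} (p : SM) (hB : QB B) (hB' : QB B')
    (h : ∀ a, p.Maps (toT a) (toT (f a)) (B (sz a))) (h' : ∀ a, sz (f a) ≤ B' (sz a)) : QP f := by
  obtain ⟨k, hk⟩ := hB
  obtain ⟨k', hk'⟩ := hB'
  exact ⟨p, max k k', fun a => ⟨(h a).mono ((hk _).trans (qb_mono_left _ (le_max_left _ _))),
    (h' a).trans ((hk' _).trans (qb_mono_left _ (le_max_right _ _)))⟩⟩

/-- A function that does not change the representation. -/
theorem of_toT_eq {f : α → β} (h : ∀ a, toT (f a) = toT a) : QP f :=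
  of_maps (.op .nop) (.const 1) .id (fun a _ _ _ => by rw [h]; exact SM.runs_op _ _)
    fun a => by rw [sz, h]; rfl

@[fun_prop]
theorem id : QP fun a : α => a := of_toT_eq fun _ => rfl

@[fun_prop]
theorem const (b : β) : QP fun _ : α => b :=
  of_maps (.constant (toT b)) ((((QB.const 7).mul .id).add (.const (sz b))).add (.const 4))
    (.const (sz b)) (fun _ => SM.maps_constant _ _) fun _ => le_rfl

-- The size bound contained in `QP` is needed here: it bounds the input, and hence the running time,
-- of the outer machine.
@[fun_prop]
theorem comp {f : β → γ} {g : α → β} (hf : QP f) (hg : QP g) : QP fun a => f (g a) := by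
  obtain ⟨p, k, hp⟩ := hf
  obtain ⟨q, j, hq⟩ := hg
  exact of_maps (.seq q p) ((QB.qb j).add ((QB.qb k).comp (.qb j))) ((QB.qb k).comp (.qb j))
    (fun a => (hq a).1.seq ((hp _).1.mono (qb_mono k (hq a).2)))
    fun a => (hp _).2.trans (qb_mono k (hq a).2)

@[fun_prop]
theorem pair {f : α → β} {g : α → γ} (hf : QP f) (hg : QP g) : QP fun a => (f a, g a) := by
  obtain ⟨p, k, hp⟩ := hf
  obtain ⟨q, j, hq⟩ := hg
  refine of_maps (.mkPair p q) (((((QB.qb k).add (.qb j)).add ((QB.const 31).mul .id)).add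
    ((QB.const 10).mul (.qb j))).add (.const 12)) (((QB.qb k).add (.qb j)).add (.const 1))
    (fun a => ((hp a).1.mkPair (hq a).1).mono ?_) fun a => ?_
  · have : (toT (g a)).size ≤ qb j (sz a) := (hq a).2
    change _ ≤ _ + _ + 31 * sz a + _ + _
    simp only [sz] at this ⊢
    omega
  · rw [sz_mk]
    have h1 := (hp a).2
    have h2 := (hq a).2
    omega

theorem fst' : QP (Prod.fst : α × β → α) :=
  of_maps .first (((QB.const 17).mul .id).add (.const 10)) .id
    (fun x => (SM.maps_first _ _).mono (by
      change 10 * sz x.1 + 17 * sz x.2 + 10 ≤ _; rw [sz_prod x]; omega))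
    fun x => by rw [sz_prod x]; omega

theorem snd' : QP (Prod.snd : α × β → β) :=
  of_maps .second (((QB.const 7).mul .id).add (.const 4)) .id
    (fun x => (SM.maps_second _ _).mono (by
      change 7 * sz x.1 + 4 ≤ _; rw [sz_prod x]; omega))
    fun x => by rw [sz_prod x]; omega

@[fun_prop]
theorem fst {f : α → β × γ} (hf : QP f) : QP fun a => (f a).1 := fst'.comp hf

@[fun_prop]
theorem snd {f : α → β × γ} (hf : QP f) : QP fun a => (f a).2 := snd'.comp hf

-- A nonempty list and the pair of its head and tail have the same tree, so pairing is all there is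
-- to compute.
@[fun_prop]
theorem cons {f : α → β} {g : α → List β} (hf : QP f) (hg : QP g) : QP fun a => f a :: g a :=
  (of_toT_eq (f := fun x : β × List β => x.1 :: x.2) fun _ => rfl).comp (hf.pair hg)

@[fun_prop]
theorem node {f g : α → Tr} (hf : QP f) (hg : QP g) : QP fun a => Tr.node (f a) (g a) :=
  (of_toT_eq (f := fun x : Tr × Tr => Tr.node x.1 x.2) fun _ => rfl).comp (hf.pair hg)

@[fun_prop]
theorem rep {f : α → β} (hf : QP f) : QP fun a => toT (f a) :=
  (of_toT_eq (f := fun b : β => toT b) fun _ => rfl).comp hf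

@[fun_prop]
theorem succ {f : α → ℕ} (hf : QP f) : QP fun a => f a + 1 :=
  (of_toT_eq (f := fun x : Unit × ℕ => x.2 + 1) fun _ => rfl).comp ((const ()).pair hf)

@[fun_prop]
theorem left {f : α → Tr} (hf : QP f) : QP fun a => (f a).left := by
  refine (of_maps (f := Tr.left) (SM.onNode .first) (((QB.const 17).mul .id).add (.const 11)) .id
    (fun t => ?_) Tr.size_left_le).comp hf
  cases t with
  | nil => exact (SM.maps_onNode_nil _).mono (by omega)
  | node l r =>
    exact (SM.maps_first l r).onNode.mono (by simp only [sz_tr, Tr.size_node]; omega)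

@[fun_prop]
theorem right {f : α → Tr} (hf : QP f) : QP fun a => (f a).right := by
  refine (of_maps (f := Tr.right) (SM.onNode .second) (((QB.const 7).mul .id).add (.const 5)) .id
    (fun t => ?_) Tr.size_right_le).comp hf
  cases t with
  | nil => exact (SM.maps_onNode_nil _).mono (by omega)
  | node l r =>
    exact (SM.maps_second l r).onNode.mono (by simp only [sz_tr, Tr.size_node]; omega)

@[fun_prop]
theorem isNode {f : α → Tr} (hf : QP f) : QP fun a => (f a).isNode := by
  refine (of_maps (f := Tr.isNode) (SM.onNode (.constant (.node .nil .nil)))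
    (((QB.const 7).mul .id).add (.const 8)) (.const 3) (fun t => ?_) fun t => ?_).comp hf
  · cases t with
    | nil => exact (SM.maps_onNode_nil _).mono (by omega)
    | node l r =>
      exact (SM.maps_constant _ _).onNode.mono (by simp only [sz_tr, Tr.size_node, Tr.size_nil]; omega)
  · exact sz_bool_le _

@[fun_prop]
theorem cond {c : α → Bool} {f g : α → β} (hc : QP c) (hf : QP f) (hg : QP g) :
    QP fun a => bif c a then f a else g a := by
  obtain ⟨p, k, hp⟩ := hc
  obtain ⟨q, j, hq⟩ := hf
  obtain ⟨r, i, hr⟩ := hg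
  refine of_maps (.cond p q r) ((((QB.qb k).add ((QB.qb j).add (.qb i))).add
    ((QB.const 21).mul .id)).add (.const 40)) ((QB.qb j).add (.qb i)) (fun a => ?_) fun a => ?_
  · have h1 := (hp a).1
    cases h : c a
    · rw [h] at h1
      refine (h1.cond_false (hr a).1).mono ?_
      simp only [sz]; omega
    · rw [h] at h1
      refine (SM.Maps.cond_true h1 (hq a).1).mono ?_
      simp only [sz, Tr.size_node, Tr.size_nil]; omega
  · have h2 := (hq a).2
    have h3 := (hr a).2
    cases h : c a <;> simp only [cond_true, cond_false] <;> omega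

end QP

/-! ### Bounded iteration -/

/-- The code of a pair is a 1 followed by the codes of its components. With this 1 removed, the top
symbol tells whether the list is empty; each round restores the 1, runs the body and removes it
again. The body is only required to work on the states that the fold reaches. -/
theorem SM.maps_loop {p : SM} {N : ℕ} (f : σ → β → σ) (l : List β) (s : σ)
    (h : ∀ l₁ b l₂, l = l₁ ++ b :: l₂ → p.Maps (toT (b :: l₂, l₁.foldl f s))
      (toT (l₂, (l₁ ++ [b]).foldl f s)) N) :
    (SM.loop p).Maps (toT (l, s)) (toT (([] : List β), l.foldl f s)) ((N + 3) * l.length + 3) := by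
  intro r i o
  have key : (SM.whl .main (fun a => a = some 1)
      (SM.seq (.op (.push .main 1)) (SM.seq p (.op (.pop .main))))).Runs
      (SM.stk ((toT l).code ++ ((toT s).code ++ r)) i o) ((N + 3) * l.length + 1)
      (SM.stk ((Tr.nil).code ++ ((toT (l.foldl f s)).code ++ r)) i o) := by
    induction l generalizing s with
    | nil => exact SM.runs_whl_false (by simp [Tr.code, Mem.tops])
    | cons b l ih =>
      have h1 := h [] b l rfl r i o
      refine (SM.runs_whl_true (by simp [Tr.code, Mem.tops]) (SM.runs_seq (SM.runs_op _ _)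
        (SM.runs_seq (N := N) (m' := SM.stk ((toT (l, f s b)).code ++ r) i o) ?_
        (SM.runs_op _ _))) (N' := (N + 3) * l.length + 1) ?_).mono ?_
      · simpa [Tr.code] using h1
      · have := ih (f s b) fun l₁ b' l₂ e => by simpa using h (b :: l₁) b' l₂ (by simp [e])
        simpa [Tr.code] using this
      · simp only [List.length_cons, mul_add]; omega
  refine (SM.runs_seq (SM.runs_op _ _) (SM.runs_seq (N := (N + 3) * l.length + 1) (N' := 1)
    (m' := SM.stk ((Tr.nil).code ++ ((toT (l.foldl f s)).code ++ r)) i o) ?_ ?_)).mono ?_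
  · simpa [Tr.code] using key
  · simpa [Tr.code] using SM.runs_op (.push .main 1)
      (SM.stk ((Tr.nil).code ++ ((toT (l.foldl f s)).code ++ r)) i o)
  · omega

namespace QP

/-- Iterating a quasi-polynomial step could square the size each time, so the intermediate
accumulators need a bound in advance. The parameter `a` travels with the accumulator because the
body depends on it. -/
theorem foldl_of_bound {g : α → List β} {h : α → σ} {f : α → σ → β → σ} {B : ℕ → ℕ}
    (hg : QP g) (hh : QP h) (hf : QP fun x : α × σ × β => f x.1 x.2.1 x.2.2) (hB : QB B)
    (H : ∀ a l₁ l₂, g a = l₁ ++ l₂ → sz (l₁.foldl (f a) (h a)) ≤ B (sz a)) :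
    QP fun a => (g a).foldl (f a) (h a) := by
  have hF : QP fun x : (β × List β) × (σ × α) => (x.1.2, (f x.2.2 x.2.1 x.1.1, x.2.2)) :=
    (snd (fst id)).pair ((hf.comp ((snd (snd id)).pair ((fst (snd id)).pair (fst (fst id))))).pair
      (snd (snd id)))
  obtain ⟨p, k, hp⟩ := hF
  have hfold : ∀ a (l : List β), l.foldl (fun (x : σ × α) b => (f x.2 x.1 b, x.2)) (h a, a) =
      (l.foldl (f a) (h a), a) := by
    intro a l
    generalize h a = s
    induction l generalizing s with
    | nil => rfl
    | cons b l ih => exact ih _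
  obtain ⟨j, hj⟩ : QP g := hg
  obtain ⟨j', hj'⟩ := hj
  have hstart : QP fun a => (g a, (h a, a)) := pair ⟨j, j', hj'⟩ (hh.pair id)
  have hB2 : QB fun n => qb j' n + B n + n + 2 := (((QB.qb j').add hB).add .id).add (.const 2)
  have hloop : ∃ q : SM, ∃ C, QB C ∧ ∀ a, q.Maps (toT (g a, (h a, a)))
      (toT (([] : List β), ((g a).foldl (f a) (h a), a))) (C (sz a)) := by
    refine ⟨SM.loop p, fun n => (qb k (qb j' n + B n + n + 2) + 3) * qb j' n + 3,
      ((((QB.qb k).comp hB2).add (.const 3)).mul (.qb j')).add (.const 3), fun a => ?_⟩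
    have := SM.maps_loop (p := p) (N := qb k (qb j' (sz a) + B (sz a) + sz a + 2))
      (fun (x : σ × α) b => (f x.2 x.1 b, x.2)) (g a) (h a, a) ?_
    · rw [hfold] at this
      refine this.mono ?_
      have h1 := (length_lt_sz (g a)).le.trans (hj' a).2
      have := Nat.mul_le_mul_left (qb k (qb j' (sz a) + B (sz a) + sz a + 2) + 3) h1
      simp only
      omega
    · intro l₁ b l₂ e
      have h1 := (hp ((b, l₂), (l₁.foldl (f a) (h a), a))).1
      rw [List.foldl_append, hfold]
      refine SM.Maps.mono h1 (qb_mono k ?_)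
      have h2 := H a l₁ _ e
      have h3 := (hj' a).2
      have h4 := sz_append l₁ (b :: l₂)
      have h5 := sz_pos l₁
      rw [e] at h3
      simp only [sz_mk, sz_cons] at h3 h4 ⊢
      omega
  obtain ⟨q, C, hC, hq⟩ := hloop
  obtain ⟨p₀, k₀, hp₀⟩ := hstart
  have hmid : QB fun n => B n + n + 10 := (hB.add .id).add (.const 10)
  -- The loop leaves `([], (result, a))`, from which the two projections extract the result.
  refine of_maps (.seq p₀ (.seq q (.seq .second .first)))
    ((QB.qb k₀).add (hC.add ((QB.const 20).add (((QB.const 17).mul hmid))))) hB (fun a => ?_)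
    fun a => H a (g a) [] (by simp)
  refine ((hp₀ a).1.seq ((hq a).seq (SM.Maps.seq (SM.maps_second _ _)
    (SM.maps_first _ _)))).mono ?_
  have h1 := H a (g a) [] (by simp)
  simp only [sz, toT_nil, Tr.size_nil] at h1 ⊢
  omega

/-- Iteration where each step adds a bounded amount to the size. -/
theorem foldl_of_add {g : α → List β} {h : α → σ} {f : α → σ → β → σ} {C : ℕ → ℕ}
    (hg : QP g) (hh : QP h) (hf : QP fun x : α × σ × β => f x.1 x.2.1 x.2.2) (hC : QB C)
    (H : ∀ a s b, b ∈ g a → sz (f a s b) ≤ sz s + C (sz a + sz b)) :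
    QP fun a => (g a).foldl (f a) (h a) := by
  obtain ⟨k, hk⟩ := hC
  have hg' := hg
  have hh' := hh
  obtain ⟨_, i, hi⟩ := hg'
  obtain ⟨_, j, hj⟩ := hh'
  refine foldl_of_bound (B := fun n => qb j n + qb i n * qb k (n + qb i n)) hg hh hf
    ((QB.qb j).add ((QB.qb i).mul ((QB.qb k).comp (QB.id.add (.qb i))))) fun a l₁ l₂ e => ?_
  have h1 : ∀ (l : List β) s, (∀ b ∈ l, b ∈ g a) →
      sz (l.foldl (f a) s) ≤ sz s + l.length * qb k (sz a + qb i (sz a)) := by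
    intro l
    induction l with
    | nil => intro s _; simp
    | cons b l ih =>
      intro s hb
      have h2 := ih (f a s b) fun b' hb' => hb b' (by simp [hb'])
      have h3 := H a s b (hb b (by simp))
      have h4 := hk (sz a + sz b)
      have h5 : qb k (sz a + sz b) ≤ qb k (sz a + qb i (sz a)) := qb_mono k
        (Nat.add_le_add_left ((sz_lt_of_mem (hb b (by simp))).le.trans (hi a).2) _)
      simp only [List.foldl_cons, List.length_cons, add_mul]
      omega
  refine (h1 l₁ (h a) fun b hb => by rw [e]; simp [hb]).trans (Nat.add_le_add (hj a).2
    (Nat.mul_le_mul_right _ ?_))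
  have h2 := (length_lt_sz (g a)).le.trans (hi a).2
  rw [e] at h2
  simp only [List.length_append] at h2
  omega

end QP

end

section

variable {α β γ δ σ : Type} [TreeRep α] [TreeRep β] [TreeRep γ] [TreeRep δ] [TreeRep σ]

/-! ### Lists -/

theorem foldl_const_eq_iterate {ι τ : Type} {f : τ → τ} (l : List ι) (s : τ) :
    l.foldl (fun s _ => f s) s = f^[l.length] s := by
  induction l generalizing s with
  | nil => rfl
  | cons b l ih => exact ih _

/-- The elements on the right spine of a tree. -/
def Tr.asList : Tr → List Tr
  | .nil => []
  | .node l r => l :: r.asList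

@[simp] theorem toT_asList (t : Tr) : toT t.asList = t := by
  induction t with
  | nil => rfl
  | node l r _ ih => simp [Tr.asList, ih]

@[simp] theorem asList_toT (l : List Tr) : (toT l).asList = l := by
  induction l with
  | nil => rfl
  | cons a l ih => simp [Tr.asList, ih]

theorem sz_asList (t : Tr) : sz t.asList = t.size := by rw [sz, toT_asList]

@[simp] theorem right_toT_nat (n : ℕ) : (toT n).right = toT (n - 1) := by cases n <;> rfl

@[simp] theorem isNode_toT_nat (n : ℕ) : (toT n).isNode = decide (n ≠ 0) := by
  cases n <;> simp [Tr.isNode]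

@[simp] theorem right_toT_list (l : List α) : (toT l).right = toT l.tail := by cases l <;> rfl

@[simp] theorem left_toT_listBool (l : List Bool) : (toT l).left = toT l.headI := by
  cases l <;> rfl

@[simp] theorem isNode_toT_bool (b : Bool) : (toT b).isNode = b := by cases b <;> rfl

namespace QP

theorem of_rep {f : α → β} (h : QP fun a => toT (f a)) : QP f := by
  obtain ⟨p, k, hp⟩ := h
  exact ⟨p, k, fun a => hp a⟩

@[fun_prop]
theorem asList {f : α → Tr} (hf : QP f) : QP fun a => (f a).asList :=
  of_rep (by simpa using hf)

theorem iterate_of_bound {n : α → ℕ} {h : α → σ} {f : α → σ → σ} {B : ℕ → ℕ}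
    (hn : QP n) (hh : QP h) (hf : QP fun x : α × σ => f x.1 x.2) (hB : QB B)
    (H : ∀ a i, i ≤ n a → sz ((f a)^[i] (h a)) ≤ B (sz a)) :
    QP fun a => (f a)^[n a] (h a) := by
  -- A unary number and a list of that many units have the same tree, which turns iteration into a
  -- fold.
  have h1 : QP fun a => List.replicate (n a) () := by
    refine of_rep ?_
    have : ∀ m : ℕ, toT (List.replicate m ()) = toT m := by
      intro m
      induction m with
      | zero => rfl
      | succ m ih => simp [List.replicate_succ, ih]
    simp only [this]
    fun_prop
  have h2 : QP fun a => (List.replicate (n a) ()).foldl (fun s _ => f a s) (h a) := by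
    refine foldl_of_bound (f := fun a s _ => f a s) h1 hh
      (hf.comp (pair (fst id) (fst (snd id)))) hB fun a l₁ l₂ e => ?_
    rw [foldl_const_eq_iterate]
    refine H a _ ?_
    have := congrArg List.length e
    simp at this
    omega
  simpa [foldl_const_eq_iterate] using h2

theorem iterate_of_add {n : α → ℕ} {h : α → σ} {f : α → σ → σ} {C : ℕ → ℕ}
    (hn : QP n) (hh : QP h) (hf : QP fun x : α × σ => f x.1 x.2) (hC : QB C)
    (H : ∀ a s, sz (f a s) ≤ sz s + C (sz a)) : QP fun a => (f a)^[n a] (h a) := by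
  obtain ⟨_, i, hi⟩ := _root_.id hn
  obtain ⟨_, j, hj⟩ := _root_.id hh
  refine iterate_of_bound (B := fun m => qb j m + qb i m * C m) hn hh hf
    ((QB.qb j).add ((QB.qb i).mul hC)) fun a m hm => ?_
  have h1 : ∀ m, sz ((f a)^[m] (h a)) ≤ sz (h a) + m * C (sz a) := by
    intro m
    induction m with
    | zero => simp
    | succ m ih =>
      rw [Function.iterate_succ_apply']
      have := H a ((f a)^[m] (h a))
      rw [add_mul]; omega
  refine (h1 m).trans (Nat.add_le_add (hj a).2 (Nat.mul_le_mul_right _ (hm.trans ?_)))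
  have := (hi a).2
  rw [sz_nat] at this
  omega

@[fun_prop]
theorem reverse {g : α → List β} (hg : QP g) : QP fun a => (g a).reverse := by
  have : QP fun a => (g a).foldl (fun s b => b :: s) [] :=
    foldl_of_add (f := fun _ s b => b :: s) hg (const []) (by fun_prop) (QB.id.add (.const 1))
      fun a s b _ => by rw [sz_cons]; omega
  simpa using this

@[fun_prop]
theorem append {g h : α → List β} (hg : QP g) (hh : QP h) : QP fun a => g a ++ h a := by
  have : QP fun a => (g a).reverse.foldl (fun s b => b :: s) (h a) :=
    foldl_of_add (f := fun _ s b => b :: s) (reverse hg) hh (by fun_prop) (QB.id.add (.const 1))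
      fun a s b _ => by rw [sz_cons]; omega
  simpa using this

@[fun_prop]
theorem length {g : α → List β} (hg : QP g) : QP fun a => (g a).length := by
  have : QP fun a => (g a).foldl (fun s _ => s + 1) 0 :=
    foldl_of_add (f := fun _ s _ => s + 1) hg (const 0) (by fun_prop) (QB.const 2)
      fun a s b _ => by simp; omega
  simpa using this

theorem map {g : α → List β} {f : α → β → γ} (hg : QP g) (hf : QP fun x : α × β => f x.1 x.2) :
    QP fun a => (g a).map (f a) := by
  obtain ⟨_, k, hk⟩ := _root_.id hf
  have h1 : QP fun a => (g a).foldl (fun s b => f a b :: s) [] :=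
    foldl_of_add (f := fun a s b => f a b :: s) (C := fun n => qb k (n + 1) + 1) hg (const [])
      (by fun_prop) (((QB.qb k).comp (QB.id.add (.const 1))).add (.const 1)) fun a s b _ => by
        have : sz (f a b) ≤ _ := (hk (a, b)).2
        rw [sz_mk] at this
        rw [sz_cons]
        omega
  have h2 : ∀ a (l : List β) (s : List γ),
      l.foldl (fun s b => f a b :: s) s = (l.map (f a)).reverse ++ s := by
    intro a l
    induction l with
    | nil => simp
    | cons b l ih => simp [ih]
  simpa [h2] using reverse h1

@[fun_prop]
theorem tail {g : α → List β} (hg : QP g) : QP fun a => (g a).tail :=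
  of_rep (by simp only [← right_toT_list]; fun_prop)

@[fun_prop]
theorem headI_bool {g : α → List Bool} (hg : QP g) : QP fun a => (g a).headI :=
  of_rep (by simp only [← left_toT_listBool]; fun_prop)

/-! ### Numbers -/

@[fun_prop]
theorem ne_zero {f : α → ℕ} (hf : QP f) : QP fun a => decide (f a ≠ 0) := by
  simp only [← isNode_toT_nat]; fun_prop

@[fun_prop]
theorem pred {f : α → ℕ} (hf : QP f) : QP fun a => f a - 1 :=
  of_rep (by simp only [← right_toT_nat]; fun_prop)

@[fun_prop]
theorem add {f g : α → ℕ} (hf : QP f) (hg : QP g) : QP fun a => f a + g a := by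
  have := iterate_of_add (f := fun _ n => n + 1) hg hf (by fun_prop) (QB.const 2)
    fun a s => by simp; omega
  simpa using this

@[fun_prop]
theorem sub {f g : α → ℕ} (hf : QP f) (hg : QP g) : QP fun a => f a - g a := by
  have := iterate_of_add (f := fun _ n => n - 1) hg hf (by fun_prop) (QB.const 0)
    fun a s => by simp
  have h : ∀ n m : ℕ, (fun n => n - 1)^[n] m = m - n := by
    intro n m
    induction n with
    | zero => rfl
    | succ n ih => rw [Function.iterate_succ_apply', ih]; omega
  simpa [h] using this

@[fun_prop]
theorem mul {f g : α → ℕ} (hf : QP f) (hg : QP g) : QP fun a => f a * g a := by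
  obtain ⟨_, k, hk⟩ := _root_.id hg
  have := iterate_of_add (f := fun a n => n + g a) hf (const 0) (by fun_prop) (QB.qb k)
    fun a s => by
      have := (hk a).2
      simp at this ⊢; omega
  have h : ∀ a n, (fun n => n + g a)^[n] 0 = n * g a := by
    intro a n
    induction n with
    | zero => simp
    | succ n ih => rw [Function.iterate_succ_apply', ih]; ring
  simpa [h] using this

@[fun_prop]
theorem pow {f : α → ℕ} (hf : QP f) (k : ℕ) : QP fun a => f a ^ k := by
  induction k with
  | zero => simpa using const 1
  | succ k ih => simpa [pow_succ] using mul ih hf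

/-- In unary, a power of 2 can be written down only if its value is within a quasi-polynomial bound;
doubling then produces it. -/
theorem two_pow {f : α → ℕ} {B : ℕ → ℕ} (hf : QP f) (hB : QB B)
    (H : ∀ a, 2 ^ f a ≤ B (sz a)) : QP fun a => 2 ^ f a := by
  have h : ∀ n, (fun n => n + n)^[n] 1 = 2 ^ n := by
    intro n
    induction n with
    | zero => simp
    | succ n ih => rw [Function.iterate_succ_apply', ih]; ring
  have := iterate_of_bound (f := fun _ n => n + n) hf (const 1) (by fun_prop)
    (((QB.const 2).mul hB).add (.const 1)) fun a i hi => by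
      rw [h, sz_nat]
      have h1 := Nat.pow_le_pow_right (n := 2) (by norm_num) hi
      have h2 := H a
      omega
  simpa [h] using this

@[fun_prop]
theorem not {f : α → Bool} (hf : QP f) : QP fun a => !(f a) := by
  have : QP fun a => bif f a then false else true := by fun_prop
  simpa using this

@[fun_prop]
theorem and {f g : α → Bool} (hf : QP f) (hg : QP g) : QP fun a => f a && g a := by
  have : QP fun a => bif f a then g a else false := by fun_prop
  simpa using this

@[fun_prop]
theorem or {f g : α → Bool} (hf : QP f) (hg : QP g) : QP fun a => f a || g a := by
  have : QP fun a => bif f a then true else g a := by fun_prop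
  simpa using this

@[fun_prop]
theorem xor {f g : α → Bool} (hf : QP f) (hg : QP g) : QP fun a => Bool.xor (f a) (g a) := by
  have : QP fun a => bif f a then !(g a) else g a := by fun_prop
  have h : ∀ a b, (bif a then !b else b) = Bool.xor a b := by decide
  simpa only [h] using this

@[fun_prop]
theorem half {f : α → ℕ} (hf : QP f) : QP fun a => f a / 2 := by
  -- The state is the quotient so far with a parity bit; the quotient grows at every second step.
  have h1 := iterate_of_add (f := fun _ (s : ℕ × Bool) => bif s.2 then (s.1 + 1, false)
    else (s.1, true)) hf (const (0, false)) (by fun_prop) (QB.const 2) fun a s => by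
      obtain ⟨s, b⟩ := s
      cases b <;> simp [sz_mk] <;> simp [sz]; omega
  have h : ∀ n, (fun (s : ℕ × Bool) => bif s.2 then (s.1 + 1, false)
      else (s.1, true))^[n] (0, false) = (n / 2, decide (n % 2 = 1)) := by
    intro n
    induction n with
    | zero => simp
    | succ n ih =>
      rw [Function.iterate_succ_apply', ih]
      rcases Nat.mod_two_eq_zero_or_one n with h | h
      · simp [h]; omega
      · simp [h]; omega
  simp only [h] at h1
  exact fst h1

theorem _root_.DisjointPairs.size_half {n : ℕ} (hn : n ≠ 0) : n.size = (n / 2).size + 1 := by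
  have h : Nat.bit (n.bodd) (n / 2) = n := by rw [← Nat.div2_val, Nat.bit_bodd_div2]
  have := Nat.size_bit (b := n.bodd) (n := n / 2) (by rwa [h])
  rwa [h] at this

@[fun_prop]
theorem natSize {f : α → ℕ} (hf : QP f) : QP fun a => (f a).size := by
  have h1 := iterate_of_add (f := fun _ (s : ℕ × ℕ) => bif decide (s.1 ≠ 0) then (s.1 / 2, s.2 + 1)
    else s) hf (hf.pair (const 0)) (by fun_prop) (QB.const 2) fun a s => by
      cases h : decide (s.1 ≠ 0) <;> simp [sz_prod]; omega
  have h : ∀ i n m, n.size ≤ i → ((fun (s : ℕ × ℕ) => bif decide (s.1 ≠ 0) then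
      (s.1 / 2, s.2 + 1) else s)^[i] (n, m)).2 = m + n.size := by
    intro i
    induction i with
    | zero => intro n m hn; simp at hn ⊢; omega
    | succ i ih =>
      intro n m hn
      rw [Function.iterate_succ_apply]
      by_cases h0 : n = 0
      · simpa [h0] using ih 0 m (by simp)
      · have := size_half h0
        have h2 := ih (n / 2) (m + 1) (by omega)
        simp only [ne_eq, h0, not_false_eq_true, decide_true, cond_true]
        rw [h2]; omega
  -- `n` halvings are more than enough, and once the number is 0 the state no longer changes.
  have h2 : ∀ n : ℕ, ((fun (s : ℕ × ℕ) => bif decide (s.1 ≠ 0) then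
      (s.1 / 2, s.2 + 1) else s)^[n] (n, 0)).2 = n.size := fun n => by
    rw [h n n 0 (Nat.size_le.2 Nat.lt_two_pow_self), zero_add]
  simpa only [h2] using snd h1

end QP

/-! ### Binary numbers of a fixed width -/

/-- The low-order `K` bits of the sum of two binary numbers and a carry. -/
def addW : ℕ → Bool → List Bool → List Bool → List Bool
  | 0, _, _, _ => []
  | K + 1, c, u, v => Bool.xor (Bool.xor c u.headI) v.headI ::
      addW K ((c && (u.headI || v.headI)) || (u.headI && v.headI)) u.tail v.tail

theorem binVal_cons (b : Bool) (u : List Bool) : binVal (b :: u) = 2 * binVal u + b.toNat := by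
  simp [binVal, Nat.bit_val]

theorem binVal_eq (u : List Bool) : binVal u = 2 * binVal u.tail + u.headI.toNat := by
  cases u with
  | nil => rfl
  | cons b u => exact binVal_cons b u

/-- `Nat.mod_mul` splits the sum into its lowest bit and its half; the half contains the carry,
which is checked on the eight combinations of low bits and carry. -/
theorem binVal_addW (K : ℕ) (c : Bool) (u v : List Bool) :
    binVal (addW K c u v) = (c.toNat + binVal u + binVal v) % 2 ^ K := by
  induction K generalizing c u v with
  | zero => simp [addW, binVal, Nat.mod_one]
  | succ K ih =>
    rw [addW, binVal_cons, ih, binVal_eq u, binVal_eq v, pow_succ', Nat.mod_mul]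
    generalize u.headI = a
    generalize v.headI = b
    generalize binVal u.tail = U
    generalize binVal v.tail = V
    have h : (c.toNat + (2 * U + a.toNat) + (2 * V + b.toNat)) / 2 =
        ((c && (a || b)) || (a && b)).toNat + U + V := by
      cases a <;> cases b <;> cases c <;> simp <;> omega
    have h' : (c.toNat + (2 * U + a.toNat) + (2 * V + b.toNat)) % 2 =
        (Bool.xor (Bool.xor c a) b).toNat := by
      cases a <;> cases b <;> cases c <;> simp <;> omega
    rw [h, h', add_comm]

theorem length_addW (K : ℕ) (c : Bool) (u v : List Bool) : (addW K c u v).length = K := by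
  induction K generalizing c u v with
  | zero => rfl
  | succ K ih => simp [addW, ih]

theorem sz_bits_le (u : List Bool) : sz u ≤ 4 * u.length + 1 :=
  sz_list_le fun b _ => sz_bool_le b

theorem sz_addW_le (K : ℕ) (c : Bool) (u v : List Bool) : sz (addW K c u v) ≤ 4 * K + 1 := by
  have := sz_bits_le (addW K c u v)
  rwa [length_addW] at this

/-- One step of the addition of two binary numbers; the state consists of the carry, the
remaining bits, and the bits of the sum so far, most significant bit first. -/
def addStep (s : (Bool × List Bool × List Bool) × List Bool) :
    (Bool × List Bool × List Bool) × List Bool :=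
  (((s.1.1 && (s.1.2.1.headI || s.1.2.2.headI)) || (s.1.2.1.headI && s.1.2.2.headI),
    s.1.2.1.tail, s.1.2.2.tail), Bool.xor (Bool.xor s.1.1 s.1.2.1.headI) s.1.2.2.headI :: s.2)

theorem iterate_addStep (K : ℕ) (c : Bool) (u v w : List Bool) :
    (addStep^[K] ((c, u, v), w)).2 = (addW K c u v).reverse ++ w := by
  induction K generalizing c u v w with
  | zero => rfl
  | succ K ih => rw [Function.iterate_succ_apply, addStep, ih]; simp [addW]

theorem sz_tail_le (l : List α) : sz l.tail ≤ sz l := by cases l <;> simp; omega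

@[fun_prop]
theorem QP.addW {K : α → ℕ} {c : α → Bool} {u v : α → List Bool} (hK : QP K) (hc : QP c)
    (hu : QP u) (hv : QP v) : QP fun a => addW (K a) (c a) (u a) (v a) := by
  have h := iterate_of_add (f := fun _ => addStep) hK
    ((hc.pair (hu.pair hv)).pair (const [])) (by unfold addStep; fun_prop) (QB.const 10)
    fun a s => by
      obtain ⟨⟨c, u, v⟩, w⟩ := s
      have h1 := sz_tail_le u
      have h2 := sz_tail_le v
      have h3 := sz_bool_le ((c && (u.headI || v.headI)) || (u.headI && v.headI))
      have h4 := sz_bool_le (Bool.xor (Bool.xor c u.headI) v.headI)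
      simp only [addStep, sz_mk, sz_cons]
      omega
  have h2 := reverse (snd h)
  simpa [iterate_addStep] using h2

end

/-! ### A universal machine -/

instance : TreeRep SignType :=
  ⟨fun a => match a with
    | .zero => toT 0
    | .pos => toT 1
    | .neg => toT 2⟩

/-- The member of the list `t` at the position given by the length of the list `k`. -/
def nthT (t k : Tr) : Tr := (k.asList.foldl (fun t _ => t.right) t).left

/-- The effect of an action on a tape. A tape is given by the scanned symbol and the parts to the
left and to the right. -/
def actU (a tp : Tr) : Tr :=
  bif a.right.isNode then
    bif a.right.left.isNode then
      .node tp.right.right.left (.node (.node a.left tp.right.left) tp.right.right.right)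
    else .node tp.right.left.left (.node tp.right.left.right (.node a.left tp.right.right))
  else .node a.left tp.right

/-- The effect of a list of actions on a list of tapes. -/
def actsU (acts : List Tr) (tapes : Tr) : List Tr :=
  (acts.foldl (fun (s : Tr × List Tr) a => (s.1.right, actU a s.1.left :: s.2))
    (tapes, [])).2.reverse

/-- The entry of the table that applies in a configuration. -/
def entryU (table : Tr) (c : Tr × List Tr × Tr) : Tr :=
  c.2.1.foldl (fun t tp => nthT t tp.left) (nthT table c.1)

/-- One step of the machine with the given table. A configuration consists of the state, the tapes
and the symbol last written on the output tape. -/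
def stepU (table : Tr) (c : Tr × List Tr × Tr) : Tr × List Tr × Tr :=
  bif (entryU table c).isNode then
    ((entryU table c).left, actsU (entryU table c).right.left.asList (toT c.2.1),
      bif (entryU table c).right.right.isNode then (entryU table c).right.right.left else c.2.2)
  else c

/-- The initial configuration. A description consists of a number, the initial state, the codes of
the input symbols, the tapes other than the input tape, and the table. -/
def initU (e : Tr) (w : List SignType) : Tr × List Tr × Tr :=
  (e.right.left,
    .node (toT (w.map fun a => nthT e.right.right.left (toT a))).left
      (.node .nil (toT (w.map fun a => nthT e.right.right.left (toT a))).right) ::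
        e.right.right.right.left.asList, .nil)

/-- Does the machine with description `e` accept `w` within `t` steps? -/
def acceptU (e : Tr) (t : ℕ) (w : List SignType) : Bool :=
  ((stepU e.right.right.right.right)^[t] (initU e w)).2.2.isNode

theorem size_foldl_right_le (l : List Tr) (t : Tr) :
    (l.foldl (fun t _ => t.right) t).size ≤ t.size := by
  induction l generalizing t with
  | nil => rfl
  | cons a l ih => exact (ih _).trans t.size_right_le

theorem size_nthT_le (t k : Tr) : (nthT t k).size ≤ t.size :=
  (Tr.size_left_le _).trans (size_foldl_right_le _ _)

theorem size_actU_le (a tp : Tr) : (actU a tp).size ≤ tp.size + a.size + 9 := by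
  have h1 := tp.size_left_add_size_right_le
  have h2 := tp.right.size_left_add_size_right_le
  have h3 := tp.right.right.size_left_add_size_right_le
  have h4 := tp.right.left.size_left_add_size_right_le
  have h5 := a.size_left_le
  unfold actU
  cases a.right.isNode <;> cases a.right.left.isNode <;> simp <;> omega

theorem size_entryU_le (table : Tr) (c) : (entryU table c).size ≤ table.size := by
  have h : ∀ (l : List Tr) (t : Tr), (l.foldl (fun t tp => nthT t tp.left) t).size ≤ t.size := by
    intro l
    induction l with
    | nil => intro t; rfl
    | cons a l ih => intro t; exact (ih _).trans (size_nthT_le _ _)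
  exact (h _ _).trans (size_nthT_le _ _)

theorem sz_actStep_le (s : Tr × List Tr) (a : Tr) :
    sz (s.1.right, actU a s.1.left :: s.2) ≤ sz s + sz a + 12 := by
  have h1 := s.1.size_left_add_size_right_le
  have h2 := size_actU_le a s.1.left
  simp only [sz_prod, sz_cons, sz_tr] at *
  omega

theorem sz_actsU_le (acts tapes : Tr) :
    sz (actsU acts.asList tapes) ≤ tapes.size + 12 * acts.size := by
  have h : ∀ (l : List Tr) (s : Tr × List Tr),
      sz (l.foldl (fun (s : Tr × List Tr) a => (s.1.right, actU a s.1.left :: s.2)) s) + 12 ≤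
        sz s + 12 * sz l := by
    intro l
    induction l with
    | nil => intro s; simp
    | cons a l ih =>
      intro s
      have h1 := ih (s.1.right, actU a s.1.left :: s.2)
      have h2 := sz_actStep_le s a
      simp only [List.foldl_cons, sz_cons]
      omega
  have h1 := h acts.asList (tapes, [])
  rw [sz_prod, sz_mk, sz_asList, sz_tr tapes, sz_nil] at h1
  rw [actsU, sz_reverse]
  have := sz_pos (acts.asList.foldl
    (fun (s : Tr × List Tr) a => (s.1.right, actU a s.1.left :: s.2)) (tapes, [])).1
  omega

/-- The growth in one step depends on the table only, not on the configuration, so the size stays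
linear in the number of simulated steps and `iterate_of_add` applies. -/
theorem sz_stepU_le (table : Tr) (c) : sz (stepU table c) ≤ sz c + 20 * sz table := by
  have h1 := size_entryU_le table c
  rw [stepU]
  set e := entryU table c
  have h2 := sz_actsU_le e.right.left (toT c.2.1)
  have h3 := e.size_left_le
  have h4 := e.size_right_le
  have h5 := e.right.size_left_le
  have h6 := e.right.size_right_le
  have h7 := e.right.right.size_left_le
  cases e.isNode
  · simp
  · cases e.right.right.isNode <;> simp only [cond_true, cond_false, sz_prod, sz_tr] <;>
      simp only [sz] at * <;> omega

namespace QP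

variable {α : Type} [TreeRep α]

@[fun_prop]
theorem nthT {t k : α → Tr} (ht : QP t) (hk : QP k) : QP fun a => nthT (t a) (k a) := by
  have := foldl_of_add (f := fun _ (t : Tr) _ => t.right) (asList hk) ht (by fun_prop) (QB.const 0)
    fun a s b _ => s.size_right_le
  exact left this

@[fun_prop]
theorem actU {x y : α → Tr} (hx : QP x) (hy : QP y) : QP fun a => actU (x a) (y a) := by
  unfold DisjointPairs.actU; fun_prop

@[fun_prop]
theorem actsU {x : α → List Tr} {y : α → Tr} (hx : QP x) (hy : QP y) :
    QP fun a => actsU (x a) (y a) := by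
  have := foldl_of_add (f := fun _ (s : Tr × List Tr) a => (s.1.right,
      DisjointPairs.actU a s.1.left :: s.2)) hx (hy.pair (const [])) (by fun_prop)
    (QB.id.add (.const 12)) fun a s b _ => by
      have := sz_actStep_le s b
      omega
  exact reverse (snd this)

@[fun_prop]
theorem entryU {t : α → Tr} {c : α → Tr × List Tr × Tr} (ht : QP t) (hc : QP c) :
    QP fun a => entryU (t a) (c a) :=
  foldl_of_add (f := fun _ (t tp : Tr) => DisjointPairs.nthT t tp.left) (g := fun a => (c a).2.1) (h := fun a =>
    DisjointPairs.nthT (t a) (c a).1) (by fun_prop) (by fun_prop) (by fun_prop) (QB.const 0)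
    fun a s b _ => size_nthT_le _ _

@[fun_prop]
theorem stepU {t : α → Tr} {c : α → Tr × List Tr × Tr} (ht : QP t) (hc : QP c) :
    QP fun a => stepU (t a) (c a) := by
  unfold DisjointPairs.stepU; fun_prop

@[fun_prop]
theorem initU {e : α → Tr} {w : α → List SignType} (he : QP e) (hw : QP w) :
    QP fun a => initU (e a) (w a) := by
  have : QP fun a => (w a).map fun b => DisjointPairs.nthT (e a).right.right.left (toT b) :=
    map (f := fun a b => DisjointPairs.nthT (e a).right.right.left (toT b)) hw (by fun_prop)
  unfold DisjointPairs.initU; fun_prop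

@[fun_prop]
theorem acceptU {e : α → Tr} {t : α → ℕ} {w : α → List SignType} (he : QP e) (ht : QP t)
    (hw : QP w) : QP fun a => acceptU (e a) (t a) (w a) := by
  have h := iterate_of_add (α := Tr × ℕ × List SignType)
    (f := fun x => DisjointPairs.stepU x.1.right.right.right.right)
    (n := fun x => x.2.1) (h := fun x => DisjointPairs.initU x.1 x.2.2)
    (C := fun n => 20 * n)
    (by fun_prop) (by fun_prop) (by fun_prop) ((QB.const 20).mul .id) fun x s => by
      have h1 := sz_stepU_le x.1.right.right.right.right s
      have h2 := x.1.size_right_le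
      have h3 := x.1.right.size_right_le
      have h4 := x.1.right.right.size_right_le
      have h5 := x.1.right.right.right.size_right_le
      simp only [sz_prod x, sz_tr] at h1 ⊢
      omega
  have h' := h.comp (he.pair (ht.pair hw))
  unfold DisjointPairs.acceptU; fun_prop

end QP

/-! ### Descriptions of Turing machines -/

open Classical in
/-- An enumeration of a finite type, starting with a given element. -/
noncomputable def enum {X : Type} [Finite X] (x : X) : List X :=
  x :: (@Finset.univ X (Fintype.ofFinite X)).toList

open Classical in
/-- The position of an element in the enumeration. -/
noncomputable def pos {X : Type} [Finite X] (x y : X) : ℕ := (enum x).idxOf y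

theorem pos_self {X : Type} [Finite X] (x : X) : pos x x = 0 := by simp [pos, enum]

open Classical in
theorem enum_getElem?_pos {X : Type} [Finite X] (x y : X) : (enum x)[pos x y]? = some y := by
  have h : y ∈ enum x := by
    simp [enum]
  rw [pos, List.getElem?_eq_getElem (List.idxOf_lt_length_iff.2 h), List.getElem_idxOf]

theorem nthT_toT_map {X : Type} (f : X → Tr) (l : List X) (n : ℕ) {x : X} (h : l[n]? = some x) :
    nthT (toT (l.map f)) (toT n) = f x := by
  induction n generalizing l with
  | zero =>
    cases l with
    | nil => simp at h
    | cons a l => simp at h; subst h; rfl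
  | succ n ih =>
    cases l with
    | nil => simp at h
    | cons a l => exact ih l (by simpa using h)

theorem nthT_enum {X : Type} [Finite X] (f : X → Tr) (x y : X) :
    nthT (toT ((enum x).map f)) (toT (pos x y)) = f y :=
  nthT_toT_map f _ _ (enum_getElem?_pos x y)

namespace TM

variable {α β : Type} (M : TM α β)

open Classical in
/-- The tapes in a fixed order, starting with the input tape. -/
noncomputable def ixs : List M.Ix :=
  M.inputIx :: ((@Finset.univ M.Ix (Fintype.ofFinite M.Ix)).erase M.inputIx).toList

/-- The code of a tape symbol. -/
noncomputable def symCode (a : M.Sym) : Tr := toT (pos default a)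

open Classical in
/-- The table of a function of the scanned symbols, as a trie. -/
noncomputable def trie (f : (M.Ix → M.Sym) → Tr) : List M.Ix → (M.Ix → M.Sym) → Tr
  | [], a => f a
  | i :: is, a => toT ((enum (default : M.Sym)).map fun b => trie f is (Function.update a i b))

/-- Each lookup replaces one coordinate of `a` by that of `g`. Once `is` lists all tapes, the
initial `a` is irrelevant. -/
theorem foldl_trie (f : (M.Ix → M.Sym) → Tr) (g : M.Ix → M.Sym) (is : List M.Ix)
    (a : M.Ix → M.Sym) (h : ∀ i ∉ is, a i = g i) :
    is.foldl (fun t i => nthT t (M.symCode (g i))) (M.trie f is a) = f g := by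
  classical
  induction is generalizing a with
  | nil => rw [List.foldl_nil, trie, funext fun i => h i (by simp)]
  | cons i is ih =>
    rw [List.foldl_cons, trie, symCode, nthT_enum, ih]
    intro j hj
    by_cases hji : j = i
    · subst hji; simp
    · rw [Function.update_of_ne hji]
      exact h j (by simp [hji, hj])

/-- The code of an action on a tape. -/
noncomputable def actCode (p : M.Sym × Option Turing.Dir) : Tr :=
  .node (M.symCode p.1) (match p.2 with
    | none => .nil
    | some .left => .node .nil .nil
    | some .right => .node (.node .nil .nil) .nil)

/-- The representation of a tape, with lists for its two parts. -/
def TapeRel (tr : Tr) (t : Turing.Tape M.Sym) : Prop :=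
  ∃ h l r, t = ⟨h, Turing.ListBlank.mk l, Turing.ListBlank.mk r⟩ ∧
    tr = .node (M.symCode h) (.node (toT (l.map M.symCode)) (toT (r.map M.symCode)))

/-- The enumeration starts with the blank to give it the code `nil`. As the head of an empty list is
also read as `nil`, cells beyond the stored part of a tape come out blank. -/
theorem symCode_default : M.symCode default = .nil := by rw [symCode, pos_self]; rfl

variable {M}

theorem tapeRel_mk (l r : List M.Sym) :
    M.TapeRel (.node (toT (r.map M.symCode)).left
      (.node (toT (l.map M.symCode)) (toT (r.map M.symCode)).right))
      (Turing.Tape.mk' (Turing.ListBlank.mk l) (Turing.ListBlank.mk r)) := by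
  refine ⟨r.headI, l, r.tail, rfl, ?_⟩
  cases r with
  | nil => simp [Tr.left, Tr.right, List.headI, symCode_default]
  | cons a r => rfl

theorem TapeRel.left {tr t} (h : M.TapeRel tr t) : tr.left = M.symCode t.head := by
  obtain ⟨_, _, _, rfl, rfl⟩ := h
  rfl

theorem TapeRel.act {tr t} (h : M.TapeRel tr t) (p) :
    M.TapeRel (actU (M.actCode p) tr) (act t p) := by
  obtain ⟨h, l, r, rfl, rfl⟩ := h
  obtain ⟨b, d⟩ := p
  cases d with
  | none => exact ⟨b, l, r, rfl, rfl⟩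
  | some d =>
    cases d with
    | left =>
      cases l with
      | nil => exact ⟨default, [], b :: r, rfl, by rw [symCode_default]; rfl⟩
      | cons a l => exact ⟨a, l, b :: r, rfl, rfl⟩
    | right =>
      cases r with
      | nil => exact ⟨default, b :: l, [], rfl, by rw [symCode_default]; rfl⟩
      | cons a r => exact ⟨a, b :: l, r, rfl, rfl⟩

theorem actsU_map {ι : Type} (A F : ι → Tr) (l : List ι) :
    actsU (l.map A) (toT (l.map F)) = l.map fun i => actU (A i) (F i) := by
  have h : ∀ (l : List ι) (s : List Tr), ((l.map A).foldl
      (fun (s : Tr × List Tr) a => (s.1.right, actU a s.1.left :: s.2)) (toT (l.map F), s)).2 =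
      (l.map fun i => actU (A i) (F i)).reverse ++ s := by
    intro l
    induction l with
    | nil => intro s; rfl
    | cons i l ih =>
      intro s
      have := ih (actU (A i) (F i) :: s)
      simpa [Tr.left, Tr.right] using this
  simp [actsU, h]

variable (M)

/-- The code of a value of the transition function. -/
noncomputable def entryCode {M : TM α Bool} :
    Option (M.State × (M.Ix → M.Sym × Option Turing.Dir) × Option Bool) → Tr
  | none => .nil
  | some (q, a, o) => .node (toT (pos M.start q))
      (.node (toT (M.ixs.map fun i => M.actCode (a i))) (match o with
        | none => .nil
        | some b => .node (toT b) .nil))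

/-- The table of a machine. -/
noncomputable def table (M : TM α Bool) : Tr :=
  toT ((enum M.start).map fun q => M.trie (fun g => entryCode (M.δ q g)) M.ixs fun _ => default)

/-- The representation of a configuration. -/
def CfgRel (M : TM α Bool) (c : Tr × List Tr × Tr) (C : M.Cfg) : Prop :=
  c.1 = toT (pos M.start C.state) ∧
  (∃ F : M.Ix → Tr, c.2.1 = M.ixs.map F ∧ ∀ i, M.TapeRel (F i) (C.tape i)) ∧
  c.2.2 = match C.out.getLast? with
    | none => .nil
    | some b => toT b

variable {M : TM α Bool}

theorem CfgRel.entryU {c C} (h : M.CfgRel c C) : entryU M.table c = entryCode (M.next C) := by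
  obtain ⟨h1, ⟨F, h2, h3⟩, -⟩ := h
  rw [DisjointPairs.entryU, h1, table, nthT_enum, h2, List.foldl_map]
  simp only [fun i => (h3 i).left]
  refine M.foldl_trie _ (fun i => (C.tape i).head) _ _ fun i hi => ?_
  exact absurd (by classical simp [ixs, em]) hi

theorem CfgRel.step {c C} (h : M.CfgRel c C) : M.CfgRel (stepU M.table c) (M.step C) := by
  rw [stepU, h.entryU, TM.step]
  obtain ⟨h1, ⟨F, h2, h3⟩, h4⟩ := h
  cases hn : M.next C with
  | none => exact ⟨h1, ⟨F, h2, h3⟩, h4⟩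
  | some x =>
    obtain ⟨q, a, o⟩ := x
    refine ⟨rfl, ⟨fun i => actU (M.actCode (a i)) (F i), ?_, fun i => (h3 i).act _⟩, ?_⟩
    · simp only [entryCode, Tr.isNode, cond_true, Tr.left, Tr.right, h2, asList_toT]
      exact actsU_map _ _ _
    · cases o with
      | none => simpa [entryCode, Tr.isNode, Tr.left, Tr.right] using h4
      | some b => simp [entryCode, Tr.isNode, Tr.left, Tr.right]

theorem CfgRel.iterate {c C} (h : M.CfgRel c C) (n : ℕ) :
    M.CfgRel ((stepU M.table)^[n] c) (M.step^[n] C) := by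
  induction n with
  | zero => exact h
  | succ n ih => simpa only [Function.iterate_succ_apply'] using ih.step

/-- A halting configuration is a fixed point of `step`. -/
theorem HaltsWithin.mono {x : List α} {m n : ℕ} {y : List Bool} (h : M.HaltsWithin x m y)
    (hmn : m ≤ n) : M.HaltsWithin x n y := by
  obtain ⟨k, rfl⟩ := Nat.exists_eq_add_of_le' hmn
  have h1 : M.step (M.step^[m] (M.init x)) = M.step^[m] (M.init x) := by
    rw [TM.step, h.1]
  rw [HaltsWithin, Function.iterate_add_apply, Function.iterate_fixed h1]
  exact h

/-- The description of a machine, with an additional number `c`. -/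
noncomputable def desc (M : TM SignType Bool) (c : ℕ) : Tr :=
  .node (toT c) (.node .nil (.node
    (toT [M.symCode (M.inputSym 0), M.symCode (M.inputSym 1), M.symCode (M.inputSym (-1))])
    (.node (toT (M.ixs.tail.map fun _ => Tr.node .nil (.node .nil .nil))) M.table)))

theorem cfgRel_init (M : TM SignType Bool) (c : ℕ) (w : List SignType) :
    M.CfgRel (initU (M.desc c) w) (M.init w) := by
  classical
  have hw : (w.map fun a => nthT (M.desc c).right.right.left (toT a)) =
      (w.map M.inputSym).map M.symCode := by
    rw [List.map_map]
    refine List.map_congr_left fun a _ => ?_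
    cases a <;> rfl
  refine ⟨by simp [initU, desc, Tr.left, Tr.right, TM.init, pos_self],
    ⟨fun i => if i = M.inputIx then .node (toT ((w.map M.inputSym).map M.symCode)).left
      (.node .nil (toT ((w.map M.inputSym).map M.symCode)).right)
      else .node .nil (.node .nil .nil), ?_, fun i => ?_⟩, rfl⟩
  · simp only [initU, hw, ixs, List.map_cons, if_true, List.cons.injEq, true_and]
    simp only [desc, Tr.left, Tr.right, asList_toT, ixs, List.tail_cons]
    refine List.map_congr_left fun i hi => ?_
    rw [Finset.mem_toList, Finset.mem_erase] at hi
    rw [if_neg hi.1]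
  · simp only [TM.init]
    by_cases hi : i = M.inputIx
    · simp only [hi, if_true]
      exact tapeRel_mk [] _
    · simp only [hi, if_false]
      exact tapeRel_mk [] []

/-- A decider writes a single bit, so the last symbol written, which is all that the simulation
keeps of the output, is the answer. Running past the halting time changes nothing. -/
theorem HaltsWithin.acceptU {M : TM SignType Bool} {w m n b} (h : M.HaltsWithin w m [b])
    (hmn : m ≤ n) (c : ℕ) : acceptU (M.desc c) n w = b := by
  have h1 := ((cfgRel_init M c w).iterate n).2.2
  rw [(h.mono hmn).2] at h1
  rw [DisjointPairs.acceptU]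
  change (((stepU M.table)^[n] (initU (M.desc c) w)).2.2).isNode = b
  rw [h1]
  exact isNode_toT_bool b

end TM

/-! ### Deciding with a clock -/

/-- Does the machine with description `e` accept `w` within the number of steps that `k` and `e`
allow? -/
def clocked (k : ℕ) (e : Tr) (w : List SignType) : Bool :=
  acceptU e (e.left.asList.length * 2 ^ ((w.length.size + 1) ^ k) + e.left.asList.length) w

/-- The clock constant is stored in unary inside the description, so it is bounded by the size of
the input and the number of simulated steps is quasi-polynomial for fixed `k`. -/
theorem QP.clocked (k : ℕ) {α : Type} [TreeRep α] {e : α → Tr} {w : α → List SignType}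
    (he : QP e) (hw : QP w) : QP fun a => clocked k (e a) (w a) := by
  have h : QP fun w : List SignType => 2 ^ ((w.length.size + 1) ^ k) :=
    two_pow (by fun_prop) (QB.qb (k + 1)) fun w => Nat.pow_le_pow_right (by norm_num) <| by
      have h1 := Nat.size_le_size (length_lt_sz w).le
      calc _ ≤ ((sz w).size + (k + 1)) ^ k := Nat.pow_le_pow_left (by omega) k
        _ ≤ _ := Nat.pow_le_pow_right (by omega) (by omega)
  have h' := h.comp hw
  unfold DisjointPairs.clocked; fun_prop

theorem quasiPoly_le (k n : ℕ) : quasiPoly k n ≤ 2 ^ ((n.size + 1) ^ k) := by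
  have h0 : 0 ≤ Real.logb 2 (n : ℝ) := by
    rcases Nat.eq_zero_or_pos n with rfl | hn
    · simp
    · exact Real.logb_nonneg (by norm_num) (by exact_mod_cast hn)
  have h1 : Real.logb 2 (n : ℝ) ≤ ((n.size + 1 : ℕ) : ℝ) := by
    rcases Nat.eq_zero_or_pos n with rfl | hn
    · simp
    · rw [Real.logb_le_iff_le_rpow (by norm_num) (by exact_mod_cast hn), Real.rpow_natCast]
      have := Nat.lt_size_self n
      have h2 : n ≤ 2 ^ (n.size + 1) := by rw [pow_succ]; omega
      exact_mod_cast h2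
  have h2 := pow_le_pow_left₀ h0 h1 k
  calc quasiPoly k n ≤ (2 : ℝ) ^ (((n.size + 1 : ℕ) : ℝ) ^ k) :=
        Real.rpow_le_rpow_of_exponent_le (by norm_num) h2
    _ = _ := by rw [← Nat.cast_pow, Real.rpow_natCast]

/-- The constant hidden in the O of the time bound becomes the left part of the description, where
the clock finds it. -/
theorem exists_clocked {k : ℕ} {C : Set (List SignType)} (hC : C ∈ DTIME (quasiPoly k)) :
    ∃ l r, ∀ w, clocked k (.node l r) w = true ↔ w ∈ C := by
  classical
  obtain ⟨M, c, hM⟩ := hC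
  refine ⟨toT c, (M.desc c).right, fun w => ?_⟩
  obtain ⟨T, hT, h⟩ := hM w
  have hT' : T ≤ c * 2 ^ ((w.length.size + 1) ^ k) + c := by
    have h1 := mul_le_mul_of_nonneg_left (quasiPoly_le k w.length) (Nat.cast_nonneg (α := ℝ) c)
    have h2 : (T : ℝ) ≤ ((c * 2 ^ ((w.length.size + 1) ^ k) + c : ℕ) : ℝ) := by
      push_cast; linarith
    exact_mod_cast h2
  have hc : (toT c).asList.length = c := by
    clear hM hT hT'
    induction c with
    | zero => rfl
    | succ c ih => simp [Tr.asList, ih]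
  have := h.acceptU hT' c
  rw [clocked]
  simp only [Tr.left, hc]
  refine (Bool.eq_iff_iff.1 this).trans ?_
  simp

/-! ### Numbering the descriptions -/

/-- One step of reading a tree in postfix notation from the binary expansion of a number; the second
component is the stack. -/
def parseStep (s : ℕ × Tr) : ℕ × Tr :=
  bif decide (s.1 ≠ 0) then
    (s.1 / 2, bif decide (s.1 - 2 * (s.1 / 2) ≠ 0) then
      .node (.node s.2.right.left s.2.left) s.2.right.right else .node .nil s.2)
  else s

/-- The tree with number `j`. -/
def treeOf (j : ℕ) : Tr := (parseStep^[j] (j, .nil)).2.left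

theorem QP.treeOf {α : Type} [TreeRep α] {j : α → ℕ} (hj : QP j) : QP fun a => treeOf (j a) := by
  have := iterate_of_add (f := fun _ => parseStep) hj (hj.pair (const .nil))
    (by unfold parseStep; fun_prop) (QB.const 10) fun a s => by
      obtain ⟨m, t⟩ := s
      have h1 := t.size_left_add_size_right_le
      have h2 := t.right.size_left_add_size_right_le
      simp only [parseStep]
      cases decide (m ≠ 0) <;> cases decide (m - 2 * (m / 2) ≠ 0) <;>
        simp [sz_mk, sz_tr] <;> omega
  unfold DisjointPairs.treeOf; fun_prop

theorem parseStep_even {m : ℕ} (hm : 0 < m) (t : Tr) : parseStep (2 * m, t) = (m, .node .nil t) := by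
  have : 2 * m ≠ 0 := by omega
  simp [parseStep, this]

theorem parseStep_odd (m : ℕ) (l r t : Tr) :
    parseStep (2 * m + 1, .node r (.node l t)) = (m, .node (.node l r) t) := by
  have h1 : (2 * m + 1) / 2 = m := by omega
  have h2 : 2 * m + 1 - 2 * m = 1 := by omega
  simp [parseStep, h1, h2, Tr.left, Tr.right]

/-- Digits are read from the low end, so the postfix code of `e` is placed below the digits of `m`.
Positivity keeps the digit 0 of a leaf from becoming a leading zero, which would not be read. -/
theorem exists_parse (e : Tr) (m : ℕ) (hm : 0 < m) :
    ∃ m', 0 < m' ∧ ∃ n, ∀ t, parseStep^[n] (m', t) = (m, .node e t) := by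
  induction e generalizing m with
  | nil => exact ⟨2 * m, by omega, 1, fun t => parseStep_even hm t⟩
  | node l r ihl ihr =>
    obtain ⟨m₁, h₁, n₁, e₁⟩ := ihr (2 * m + 1) (by omega)
    obtain ⟨m₂, h₂, n₂, e₂⟩ := ihl m₁ h₁
    refine ⟨m₂, h₂, 1 + (n₁ + n₂), fun t => ?_⟩
    rw [Function.iterate_add_apply, Function.iterate_add_apply, e₂, e₁]
    exact parseStep_odd m l r t

theorem exists_treeOf (l r : Tr) : ∃ j, treeOf j = .node l r := by
  -- The 1 is the leading digit and the last to be read: it joins the two subtrees and leaves 0.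
  obtain ⟨m₁, h₁, n₁, e₁⟩ := exists_parse r 1 (by omega)
  obtain ⟨j, _, n₂, e₂⟩ := exists_parse l m₁ h₁
  have h1 : parseStep^[1 + (n₁ + n₂)] (j, .nil) = (0, .node (.node l r) .nil) := by
    rw [Function.iterate_add_apply, Function.iterate_add_apply, e₂, e₁]
    exact parseStep_odd 0 l r .nil
  have hfix : ∀ t : Tr, parseStep (0, t) = (0, t) := fun t => rfl
  have hhalf : ∀ n m (t : Tr), m < 2 ^ n → (parseStep^[n] (m, t)).1 = 0 := by
    intro n
    induction n with
    | zero => intro m t h; simpa using h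
    | succ n ih =>
      intro m t h
      rw [Function.iterate_succ_apply]
      rcases Nat.eq_zero_or_pos m with rfl | hm
      · exact ih 0 t (by positivity)
      · have hm' : decide (m ≠ 0) = true := by simp; omega
        rw [parseStep]
        simp only [hm', cond_true]
        exact ih _ _ (by rw [pow_succ] at h; omega)
  refine ⟨j, ?_⟩
  obtain ⟨t, ht⟩ : ∃ t, parseStep^[j] (j, .nil) = (0, t) :=
    ⟨_, Prod.ext (hhalf j j .nil Nat.lt_two_pow_self) rfl⟩
  -- Both `j` steps and `1 + (n₁ + n₂)` steps end in a fixed point; performing both numbers of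
  -- steps, in either order, shows that the fixed points agree.
  have h2 : parseStep^[(1 + (n₁ + n₂)) + j] (j, .nil) = (0, t) := by
    rw [Function.iterate_add_apply, ht, Function.iterate_fixed (hfix _)]
  rw [add_comm, Function.iterate_add_apply, h1, Function.iterate_fixed (hfix _)] at h2
  rw [treeOf, ht, ← (Prod.ext_iff.1 h2).2]
  rfl

/-! ### Input and output -/

instance : TreeRep (Option Bool) :=
  ⟨fun a => match a with
    | none => .nil
    | some b => .node .nil (toT b)⟩

theorem sz_sign_le (a : SignType) : sz a ≤ 5 := by
  cases a
  · exact (by decide : 1 ≤ 5)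
  · exact (by decide : 5 ≤ 5)
  · exact (by decide : 3 ≤ 5)

namespace SM

/-- Replace the input by a list on the stack, in reverse order. -/
def load : SM :=
  seq (op (.push .main 0)) (whl .inp Option.isSome (branch .inp fun a =>
    seq (op (.pop .inp)) (pushAll (1 :: (toT a).code))))

theorem runs_load (w : List SignType) (o : List (Option Bool)) :
    load.Runs (stk [] w o) (11 * w.length + 2) (stk (toT w.reverse).code [] o) := by
  have key : ∀ l : List SignType, (whl .inp Option.isSome (branch .inp fun a =>
      seq (op (.pop .inp)) (pushAll (1 :: (toT a).code)))).Runs (stk (toT l).code w o)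
      (11 * w.length + 1) (stk (toT (w.reverse ++ l)).code [] o) := by
    induction w with
    | nil => exact fun l => runs_whl_false rfl
    | cons a w ih =>
      intro l
      refine (runs_whl_true rfl (runs_branch a rfl (runs_seq (runs_op _ _)
        (by simpa using runs_pushAll (1 :: (toT a).code)))) (N' := 11 * w.length + 1) ?_).mono ?_
      · simpa [Tr.code] using ih (a :: l)
      · have := sz_sign_le a
        simp only [sz, List.length_cons] at this ⊢
        omega
  exact (runs_seq (runs_op _ _) (by simpa [Tr.code] using key [])).mono (by omega)

/-- Write the list on the stack on the output tape. -/
def write : SM :=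
  whl .main (fun a => a = some 1) (seq (op (.pop .main)) (ite .main (fun a => a = some 1)
    (seq (op (.pop .main)) (seq (op (.pop .main)) (ite .main (fun a => a = some 1)
      (seq (op (.pop .main)) (seq (op (.pop .main)) (seq (op (.pop .main))
        (op (.emit (some true))))))
      (seq (op (.pop .main)) (op (.emit (some false)))))))
    (seq (op (.pop .main)) (op (.emit none)))))

theorem runs_write (l : List (Option Bool)) (i : List SignType) (o : List (Option Bool)) :
    write.Runs (stk (toT l).code i o) (10 * l.length + 1) (stk [0] i (o ++ l)) := by
  induction l generalizing o with
  | nil => simpa [Tr.code, write] using runs_whl_false (by simp [Mem.tops])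
  | cons a l ih =>
    have h : (seq (op (.pop .main)) (ite .main (fun a => a = some 1)
        (seq (op (.pop .main)) (seq (op (.pop .main)) (ite .main (fun a => a = some 1)
          (seq (op (.pop .main)) (seq (op (.pop .main)) (seq (op (.pop .main))
            (op (.emit (some true))))))
          (seq (op (.pop .main)) (op (.emit (some false)))))))
        (seq (op (.pop .main)) (op (.emit none))))).Runs (stk (toT (a :: l)).code i o) 9
        (stk (toT l).code i (o ++ [a])) := by
      match a with
      | none =>
        exact (runs_seq (runs_op _ _) (runs_ite_false (by simp [Tr.code, Mem.tops, toT])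
          (runs_seq (runs_op _ _) (by
            simpa [Tr.code, toT] using runs_op (.emit none) (stk (toT l).code i o))))).mono
          (by omega)
      | some false =>
        exact (runs_seq (runs_op _ _) (runs_ite_true (by simp [Tr.code, Mem.tops, toT])
          (runs_seq (runs_op _ _) (runs_seq (runs_op _ _)
            (runs_ite_false (by simp [Tr.code, Mem.tops, toT]) (runs_seq (runs_op _ _) (by
            simpa [Tr.code, toT] using
              runs_op (.emit (some false)) (stk (toT l).code i o)))))))).mono
          (by omega)
      | some true =>
        exact (runs_seq (runs_op _ _) (runs_ite_true (by simp [Tr.code, Mem.tops, toT])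
          (runs_seq (runs_op _ _) (runs_seq (runs_op _ _)
            (runs_ite_true (by simp [Tr.code, Mem.tops, toT]) (runs_seq (runs_op _ _)
            (runs_seq (runs_op _ _) (runs_seq (runs_op _ _) (by
            simpa [Tr.code, toT] using
              runs_op (.emit (some true)) (stk (toT l).code i o)))))))))).mono
          (by omega)
    have := runs_whl_true (by simp [Tr.code, Mem.tops]) h (ih _)
    simp only [List.append_assoc, List.singleton_append] at this
    exact this.mono (by simp only [List.length_cons]; omega)

end SM

theorem qb_le_quasiPoly (k : ℕ) : ∃ c : ℕ, ∀ n, (qb k n : ℝ) ≤ c * quasiPoly (2 * k) n + c := by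
  -- From `2 ^ (k + 3)` on, log n is at least k + 3, so `n.size + k` is at most (log n)^2; this
  -- accounts for the exponent `2 * k`. Smaller `n` are absorbed by the constant.
  refine ⟨qb k (2 ^ (k + 3)) + 1, fun n => ?_⟩
  have hpos : 0 < quasiPoly (2 * k) n := Real.rpow_pos_of_pos (by norm_num) _
  rcases le_total n (2 ^ (k + 3)) with hn | hn
  · have h1 : (qb k n : ℝ) ≤ (qb k (2 ^ (k + 3)) : ℝ) := by exact_mod_cast qb_mono k hn
    have h2 : (0 : ℝ) ≤ ((qb k (2 ^ (k + 3)) + 1 : ℕ) : ℝ) * quasiPoly (2 * k) n := by positivity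
    push_cast at h2 ⊢
    linarith
  · have hn0 : 0 < n := lt_of_lt_of_le (by positivity) hn
    have hlog : ((k + 3 : ℕ) : ℝ) ≤ Real.logb 2 n := by
      rw [Real.le_logb_iff_rpow_le (by norm_num) (by exact_mod_cast hn0), Real.rpow_natCast]
      exact_mod_cast hn
    have hsize : (n.size : ℝ) ≤ Real.logb 2 n + 1 := by
      obtain ⟨m, hm⟩ := Nat.exists_eq_add_of_lt (Nat.size_pos.2 hn0)
      have h1 : 2 ^ m ≤ n := Nat.lt_size.1 (by omega)
      have h2 : (m : ℝ) ≤ Real.logb 2 n := by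
        rw [Real.le_logb_iff_rpow_le (by norm_num) (by exact_mod_cast hn0), Real.rpow_natCast]
        exact_mod_cast h1
      rw [hm]
      push_cast
      linarith
    push_cast at hlog
    have hk : (0 : ℝ) ≤ k := Nat.cast_nonneg k
    have h1 : ((n.size + k : ℕ) : ℝ) ≤ Real.logb 2 n ^ 2 := by
      push_cast
      nlinarith
    have h2 : (((n.size + k) ^ k : ℕ) : ℝ) ≤ Real.logb 2 n ^ (2 * k) := by
      rw [pow_mul, Nat.cast_pow]
      exact pow_le_pow_left₀ (Nat.cast_nonneg _) h1 k
    have h3 : (qb k n : ℝ) ≤ quasiPoly (2 * k) n := by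
      rw [qb, quasiPoly, Nat.cast_pow, ← Real.rpow_natCast]
      exact Real.rpow_le_rpow_of_exponent_le (by norm_num) h2
    have h4 : (1 : ℝ) ≤ ((qb k (2 ^ (k + 3)) + 1 : ℕ) : ℝ) := by
      push_cast
      linarith [(Nat.cast_nonneg (qb k (2 ^ (k + 3))) : (0 : ℝ) ≤ _)]
    nlinarith

theorem QP.computableInTime {f : List SignType → List (Option Bool)} (hf : QP f) :
    ∃ k, ComputableInTime (quasiPoly k) f := by
  -- Loading the input onto the stack reverses it, so the program starts by reversing it back.
  have hrev : QP fun w : List SignType => f w.reverse := by fun_prop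
  obtain ⟨p, k, hp⟩ := hrev
  have hB : QB fun n => 2 * (11 * n + 2 + (qb k (6 * n + 1) + (10 * qb k (6 * n + 1) + 1))) := by
    have h1 : QB fun n => qb k (6 * n + 1) :=
      (QB.qb k).comp (((QB.const 6).mul .id).add (.const 1))
    exact (QB.const 2).mul ((((QB.const 11).mul .id).add (.const 2)).add
      (h1.add (((QB.const 10).mul h1).add (.const 1))))
  obtain ⟨K, hK⟩ := hB
  obtain ⟨c, hc⟩ := qb_le_quasiPoly K
  refine ⟨2 * K, (SM.seq SM.load (SM.seq p SM.write)).toTM, c, fun w => ?_⟩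
  have hsz : sz w.reverse ≤ 6 * w.length + 1 := by
    rw [sz_reverse]
    exact sz_list_le fun a _ => sz_sign_le a
  have hmono := qb_mono k hsz
  have h1 := (hp w.reverse).1.mono hmono [] [] []
  have h2 := (hp w.reverse).2.trans hmono
  simp only [List.reverse_reverse, List.append_nil] at h1 h2
  have hrun := SM.runs_seq (SM.runs_load w []) (SM.runs_seq h1 (SM.runs_write (f w) [] []))
  obtain ⟨T, hT, h⟩ := hrun.haltsWithin
  refine ⟨T, ?_, by simpa using h⟩
  have hlen := (length_lt_sz (f w)).le.trans h2
  have hT' : T ≤ qb K w.length := by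
    refine le_trans ?_ (hK w.length)
    simp only
    omega
  exact (Nat.cast_le.2 hT').trans (hc _)

/-! ### The martingale -/

theorem binVal_replicate_append (n : ℕ) (u : List Bool) :
    binVal (List.replicate n false ++ u) = 2 ^ n * binVal u := by
  induction n with
  | zero => simp
  | succ n ih =>
    rw [List.replicate_succ, List.cons_append, binVal_cons, ih, Bool.toNat_false, pow_succ]
    ring

/-- The binary expansion of `2 ^ n`. -/
def powBits (n : ℕ) : List Bool := List.replicate n false ++ [true]

theorem binVal_powBits (n : ℕ) : binVal (powBits n) = 2 ^ n := by
  rw [powBits, binVal_replicate_append]; simp [binVal]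

@[fun_prop]
theorem QP.powBits {α : Type} [TreeRep α] {n : α → ℕ} (hn : QP n) : QP fun a => powBits (n a) := by
  have h := iterate_of_add (f := fun _ (u : List Bool) => false :: u) hn (const [true])
    (by fun_prop) (QB.const 2) fun a s => by simp [sz]; omega
  have h' : ∀ n, (fun u => false :: u)^[n] [true] = DisjointPairs.powBits n := by
    intro n
    induction n with
    | zero => rfl
    | succ n ih => rw [Function.iterate_succ_apply', ih]; rfl
  simpa only [h'] using h

/-- A number that depends on a sign. -/
def sel (x y z : ℕ) (a : SignType) : ℕ :=
  bif (toT a).isNode then bif (toT a).right.isNode then z else y else x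

@[simp] theorem sel_zero (x y z : ℕ) : sel x y z 0 = x := rfl
@[simp] theorem sel_one (x y z : ℕ) : sel x y z 1 = y := rfl
@[simp] theorem sel_neg_one (x y z : ℕ) : sel x y z (-1) = z := rfl

@[fun_prop]
theorem QP.sel {α : Type} [TreeRep α] (x y z : ℕ) {f : α → SignType} (hf : QP f) :
    QP fun a => sel x y z (f a) := by
  unfold DisjointPairs.sel; fun_prop

section

variable (E : ℕ → List SignType → Bool)

/-- Four times the factor by which the capital of the strategy number `j` changes when the
symbol `a` follows `u`: the strategy bets against the first symbol that would lead to acceptance. -/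
def factor (j : ℕ) (u : List SignType) (a : SignType) : ℕ :=
  bif decide (j - u.length ≠ 0) then 4
  else bif E j (u ++ [0]) then sel 1 5 5 a
  else bif E j (u ++ [1]) then sel 7 0 6 a
  else bif E j (u ++ [-1]) then sel 7 6 0 a
  else 4

/-- The probabilities are 2/8, 3/8, 3/8 and the factors are scaled by 4, so fairness means the total
32. In a bet against the symbol 0 the losing factor is 1 because losing everything would force the
other two factors to add up to 32/3. -/
theorem factor_sum (j : ℕ) (u : List SignType) :
    2 * factor E j u 0 + 3 * factor E j u 1 + 3 * factor E j u (-1) = 32 := by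
  unfold factor
  cases decide (j - u.length ≠ 0) <;> cases E j (u ++ [0]) <;> cases E j (u ++ [1]) <;>
    cases E j (u ++ [-1]) <;> simp

theorem factor_le (j : ℕ) (u : List SignType) (a : SignType) : factor E j u a ≤ 7 := by
  unfold factor
  cases decide (j - u.length ≠ 0) <;> cases E j (u ++ [0]) <;> cases E j (u ++ [1]) <;>
    cases E j (u ++ [-1]) <;> cases a <;> decide

theorem factor_of_lt {j : ℕ} {u : List SignType} (h : u.length < j) (a : SignType) :
    factor E j u a = 4 := by
  have : decide (j - u.length ≠ 0) = true := by simp; omega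
  rw [factor, this, cond_true]

theorem four_le_factor (j : ℕ) (u : List SignType) (a : SignType) (h : E j (u ++ [a]) = false) :
    4 ≤ factor E j u a := by
  unfold factor
  cases a <;> simp only [SignType.zero_eq_zero, SignType.pos_eq_one, SignType.neg_eq_neg_one]
      at h ⊢ <;> rw [h] <;> cases decide (j - u.length ≠ 0) <;> cases E j (u ++ [0]) <;>
    cases E j (u ++ [1]) <;> cases E j (u ++ [-1]) <;> decide

/-- As some extension is accepted, a bet is placed. It is against the first accepted symbol, which
is not `a`, and in each of the three bets all other factors are at least 5. -/
theorem five_le_factor {j : ℕ} {u : List SignType} (hu : j ≤ u.length) {a i : SignType}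
    (h : E j (u ++ [a]) = false) (hi : E j (u ++ [i]) = true) : 5 ≤ factor E j u a := by
  have : decide (j - u.length ≠ 0) = false := by simp; omega
  unfold factor
  rw [this]
  cases a <;> cases i <;> simp only [SignType.zero_eq_zero, SignType.pos_eq_one,
      SignType.neg_eq_neg_one] at h hi ⊢ <;> simp only [h, hi] at * <;>
    cases E j (u ++ [0]) <;> cases E j (u ++ [1]) <;> cases E j (u ++ [-1]) <;> simp_all

/-- The capital of the strategy number `j`, multiplied by a power of `4`. -/
def capital (j : ℕ) (w : List SignType) : ℕ :=
  (w.foldl (fun (s : List SignType × ℕ) a => (s.1 ++ [a], s.2 * factor E j s.1 a)) ([], 1)).2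

theorem foldl_fst {σ : Type} (f : List SignType → σ → SignType → σ) (w u : List SignType) (x : σ) :
    (w.foldl (fun (s : List SignType × σ) a => (s.1 ++ [a], f s.1 s.2 a)) (u, x)).1 = u ++ w := by
  induction w generalizing u x with
  | nil => simp
  | cons a w ih => rw [List.foldl_cons, ih]; simp

theorem capital_append (j : ℕ) (w : List SignType) (a : SignType) :
    capital E j (w ++ [a]) = capital E j w * factor E j w a := by
  have h := foldl_fst (fun u x a => x * factor E j u a) w [] 1
  rw [capital, List.foldl_append]
  simp only [List.foldl_cons, List.foldl_nil, h]
  rfl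

/-- Idle strategies keep their initial capital, here scaled by a power of 4. This makes the tail of
the infinite sum explicit. -/
theorem capital_of_le {j : ℕ} {w : List SignType} (h : w.length ≤ j) :
    capital E j w = 4 ^ w.length := by
  induction w using List.reverseRecOn with
  | nil => rfl
  | append_singleton w a ih =>
    rw [List.length_append, List.length_singleton] at h
    rw [capital_append, ih (by omega), factor_of_lt E (by omega), List.length_append,
      List.length_singleton, pow_succ]

theorem capital_le (j : ℕ) (w : List SignType) : capital E j w ≤ 7 ^ w.length := by
  induction w using List.reverseRecOn with
  | nil => exact le_rfl
  | append_singleton w a ih =>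
    rw [capital_append, List.length_append, List.length_singleton, pow_succ]
    exact Nat.mul_le_mul ih (factor_le E j w a)

/-- The weighted sum of the capitals of the first `m` strategies. -/
def total (w : List SignType) : ℕ → ℕ
  | 0 => 0
  | m + 1 => 2 * total w m + capital E m w

theorem total_sum (w : List SignType) (m : ℕ) :
    2 * total E (w ++ [0]) m + 3 * total E (w ++ [1]) m + 3 * total E (w ++ [-1]) m =
      32 * total E w m := by
  induction m with
  | zero => rfl
  | succ m ih =>
    simp only [total, capital_append]
    linear_combination 2 * ih + capital E m w * factor_sum E m w

theorem total_add_le (w : List SignType) (m : ℕ) :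
    total E w m + 7 ^ w.length ≤ 2 ^ m * 7 ^ w.length := by
  induction m with
  | zero => simp [total]
  | succ m ih =>
    have := capital_le E m w
    rw [total, pow_succ, mul_comm (2 ^ m), mul_assoc]
    omega

/-- In `total E w m` the capital of strategy `j` has the weight 2^(m-1-j). -/
theorem capital_mul_le_total (w : List SignType) {j m : ℕ} (h : j < m) :
    2 ^ m * capital E j w ≤ 2 ^ (j + 1) * total E w m := by
  induction m, h using Nat.le_induction with
  | base => exact Nat.mul_le_mul_left _ (by rw [total]; omega)
  | succ m _ ih =>
    rw [total, pow_succ]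
    nlinarith [Nat.zero_le (2 ^ (j + 1) * capital E m w)]

/-- The numerator of the martingale. -/
def numer (w : List SignType) : ℕ := total E w w.length + 4 ^ w.length

/-- The martingale. -/
noncomputable def mart (w : List SignType) : ℝ≥0 := (numer E w : ℝ≥0) / (8 ^ w.length : ℕ)

theorem isPairMartingale_mart : IsPairMartingale (mart E) := by
  intro w
  have h : 2 * numer E (w ++ [0]) + 3 * numer E (w ++ [1]) + 3 * numer E (w ++ [-1]) =
      64 * numer E w := by
    -- The successors of `w` involve one more strategy than `w`. On `w` that strategy is still idle,
    -- so its share is known and can be split off the tail.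
    have h1 := total_sum E w (w.length + 1)
    rw [total.eq_2 E w, capital_of_le E le_rfl] at h1
    simp only [numer, List.length_append, List.length_singleton, pow_succ 4]
    omega
  have h' : 2 * (numer E (w ++ [0]) : ℝ≥0) + 3 * numer E (w ++ [1]) + 3 * numer E (w ++ [-1]) =
      64 * numer E w := by exact_mod_cast h
  have h8 : ((8 : ℝ≥0) ^ w.length) ≠ 0 := by positivity
  simp only [mart, List.length_append, List.length_singleton, pow_succ, Nat.cast_mul,
    Nat.cast_pow, Nat.cast_ofNat]
  field_simp
  rw [← NNReal.coe_inj] at h' ⊢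
  push_cast at h' ⊢
  linear_combination -4 * h'

theorem capital_le_mart {j : ℕ} {w : List SignType} (h : j < w.length) :
    (capital E j w : ℝ≥0) / 4 ^ w.length ≤ 2 ^ (j + 1) * mart E w := by
  have h1 := capital_mul_le_total E w h
  have h2 : 2 ^ w.length * capital E j w ≤ 2 ^ (j + 1) * numer E w :=
    h1.trans (Nat.mul_le_mul_left _ (Nat.le_add_right _ _))
  have h3 : (2 : ℝ≥0) ^ w.length * capital E j w ≤ 2 ^ (j + 1) * numer E w := by
    exact_mod_cast h2
  have h8 : (8 : ℝ≥0) ^ w.length = 2 ^ w.length * 4 ^ w.length := by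
    rw [← mul_pow]; norm_num
  rw [mart, Nat.cast_pow, Nat.cast_ofNat, h8, ← mul_div_assoc, le_div_iff₀ (by positivity)]
  calc _ = (2 : ℝ≥0) ^ w.length * capital E j w := by field_simp
    _ ≤ _ := h3

/-! ### Success along pairs that avoid a dense condition -/

theorem pre_succ (Q : DisjointPair) (n : ℕ) : Q.pre (n + 1) = Q.pre n ++ [Q.seq n] := by
  simp [DisjointPair.pre, List.range_succ]

theorem succeeds_mart {Q : DisjointPair} {j : ℕ} {C : Set (List SignType)}
    (hC : ∀ w, E j w = true ↔ w ∈ C) (hd : Q.DenseAlong C) (hm : ¬ Q.Meets C) :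
    Succeeds (mart E) Q := by
  have hlen : ∀ n, (Q.pre n).length = n := fun n => by simp [DisjointPair.pre]
  have hE : ∀ n, E j (Q.pre n) = false := fun n => by
    rw [← Bool.not_eq_true, hC]; exact fun h => hm ⟨n, h⟩
  set v : ℕ → ℝ≥0 := fun n => (capital E j (Q.pre n) : ℝ≥0) / 4 ^ n with hv
  have hstep : ∀ n, v (n + 1) = v n * (factor E j (Q.pre n) (Q.seq n) / 4) := fun n => by
    simp only [hv, pre_succ, capital_append, pow_succ, Nat.cast_mul]
    field_simp
  have hmono : Monotone v := monotone_nat_of_le_succ fun n => by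
    rw [hstep]
    have h4 := four_le_factor E j (Q.pre n) (Q.seq n) (by rw [← pre_succ]; exact hE _)
    have h4' : (4 : ℝ≥0) ≤ factor E j (Q.pre n) (Q.seq n) := by exact_mod_cast h4
    exact le_mul_of_one_le_right' ((one_le_div (by norm_num)).2 h4')
  have hunb : ∀ m : ℕ, ∃ n, (5 / 4 : ℝ≥0) ^ m ≤ v n := by
    intro m
    induction m with
    | zero => exact ⟨0, by simp [hv, DisjointPair.pre, capital]⟩
    | succ m ih =>
      obtain ⟨n, hn⟩ := ih
      -- The next winning bet has to come after the growth already secured at `n` and after strategy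
      -- `j` has become active.
      obtain ⟨n', ⟨i, hi⟩, hn'⟩ := hd.exists_gt (max n j)
      have h5 := five_le_factor E (j := j) (u := Q.pre n') (by rw [hlen]; omega)
        (a := Q.seq n') (i := i) (by rw [← pre_succ]; exact hE _) ((hC _).2 hi)
      have h5' : (5 : ℝ≥0) ≤ factor E j (Q.pre n') (Q.seq n') := by exact_mod_cast h5
      refine ⟨n' + 1, ?_⟩
      rw [hstep, pow_succ]
      exact mul_le_mul' (hn.trans (hmono (by omega))) (by gcongr)
  have hv_top : Tendsto v atTop atTop := by
    refine tendsto_atTop_atTop_of_monotone hmono fun b => ?_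
    obtain ⟨m, hm⟩ := pow_unbounded_of_one_lt b (show (1 : ℝ≥0) < 5 / 4 by
      rw [one_lt_div (by norm_num)]; norm_num)
    obtain ⟨n, hn⟩ := hunb m
    exact ⟨n, hm.le.trans hn⟩
  have hmart : Tendsto (fun n => mart E (Q.pre n)) atTop atTop := by
    have h1 : Tendsto (fun n => v n / 2 ^ (j + 1)) atTop atTop :=
      hv_top.atTop_div_const (by positivity)
    refine tendsto_atTop_mono' _ ?_ h1
    filter_upwards [eventually_gt_atTop j] with n hn
    have := capital_le_mart E (j := j) (w := Q.pre n) (by rwa [hlen])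
    rw [hlen] at this
    rw [div_le_iff₀ (by positivity), mul_comm]
    exact this
  exact (ENNReal.tendsto_coe_nhds_top.2 hmart).limsup_eq

/-! ### Computing the martingale -/

/-- The product of a small number and a binary number, modulo `2 ^ K`. -/
def mulW (K c : ℕ) (u : List Bool) : List Bool := (fun v => addW K false v u)^[c] []

theorem binVal_mulW (K c : ℕ) (u : List Bool) : binVal (mulW K c u) ≡ c * binVal u [MOD 2 ^ K] := by
  induction c with
  | zero => simp [mulW, binVal, Nat.ModEq.refl]
  | succ c ih =>
    rw [mulW, Function.iterate_succ_apply', binVal_addW, add_mul, one_mul]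
    refine (Nat.mod_modEq _ _).trans ?_
    simpa [mulW] using ih.add_right _

theorem sz_mulW_le (K c : ℕ) (u : List Bool) : sz (mulW K c u) ≤ 4 * K + 1 := by
  cases c with
  | zero => simp [mulW]
  | succ c => rw [mulW, Function.iterate_succ_apply']; exact sz_addW_le _ _ _ _

@[fun_prop]
theorem QP.mulW {α : Type} [TreeRep α] {K c : α → ℕ} {u : α → List Bool} (hK : QP K) (hc : QP c)
    (hu : QP u) : QP fun a => mulW (K a) (c a) (u a) := by
  have h := iterate_of_add (α := ℕ × ℕ × List Bool) (f := fun x v => DisjointPairs.addW x.1 false v x.2.2)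
    (n := fun x => x.2.1) (h := fun _ => []) (C := fun n => 2 * n) (by fun_prop) (by fun_prop)
    (by fun_prop) ((QB.const 2).mul .id) fun x s => by
      have := sz_addW_le x.1 false s x.2.2
      have h2 : sz x.1 = 2 * x.1 + 1 := sz_nat _
      rw [sz_prod x]
      omega
  exact h.comp (hK.pair (hc.pair hu))

/-- The capital of a strategy in binary, modulo `2 ^ K`. -/
def capitalW (K j : ℕ) (w : List SignType) : List Bool :=
  (w.foldl (fun (s : List SignType × List Bool) a =>
    (s.1 ++ [a], mulW K (factor E j s.1 a) s.2)) ([], [true])).2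

/-- Sums and products respect congruence modulo 2^K, so overflow in intermediate results needs no
attention; only the final numerator has to fit. -/
theorem binVal_capitalW (K j : ℕ) (w : List SignType) :
    binVal (capitalW E K j w) ≡ capital E j w [MOD 2 ^ K] := by
  induction w using List.reverseRecOn with
  | nil => exact Nat.ModEq.refl _
  | append_singleton w a ih =>
    have h := foldl_fst (fun u x a => mulW K (factor E j u a) x) w [] [true]
    rw [capitalW, List.foldl_append, capital_append, mul_comm]
    simp only [List.foldl_cons, List.foldl_nil, h]
    exact (binVal_mulW _ _ _).trans (ih.mul_left _)

/-- The weighted sum of the capitals in binary, modulo `2 ^ K`. -/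
def totalW (K : ℕ) (w : List SignType) (m : ℕ) : List Bool :=
  ((fun (s : ℕ × List Bool) =>
    (s.1 + 1, addW K false (addW K false s.2 s.2) (capitalW E K s.1 w)))^[m] (0, [])).2

theorem binVal_totalW (K : ℕ) (w : List SignType) (m : ℕ) :
    binVal (totalW E K w m) ≡ total E w m [MOD 2 ^ K] := by
  have h : ∀ m, ((fun (s : ℕ × List Bool) =>
      (s.1 + 1, addW K false (addW K false s.2 s.2) (capitalW E K s.1 w)))^[m] (0, [])).1 = m := by
    intro m
    induction m with
    | zero => rfl
    | succ m ih => rw [Function.iterate_succ_apply']; exact congrArg (· + 1) ih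
  induction m with
  | zero => exact Nat.ModEq.refl _
  | succ m ih =>
    rw [totalW, Function.iterate_succ_apply']
    simp only [h, binVal_addW, Bool.toNat_false, zero_add, total]
    refine (Nat.mod_modEq _ _).trans (Nat.ModEq.add ((Nat.mod_modEq _ _).trans ?_)
      (binVal_capitalW E K m w))
    rw [two_mul]
    exact ih.add ih

/-- The numerator of the martingale in binary. -/
def numerW (w : List SignType) : List Bool :=
  addW (4 * w.length + 4) false (totalW E (4 * w.length + 4) w w.length) (powBits (2 * w.length))

theorem binVal_numerW (w : List SignType) : binVal (numerW E w) = numer E w := by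
  have h1 := total_add_le E w w.length
  -- For a word of length n the numerator is at most 14^n, so the chosen width loses nothing.
  have h2 : numer E w < 2 ^ (4 * w.length + 4) := by
    have h3 : 4 ^ w.length ≤ 7 ^ w.length := Nat.pow_le_pow_left (by norm_num) _
    have h4 : 2 ^ w.length * 7 ^ w.length ≤ 2 ^ (4 * w.length) := by
      rw [← mul_pow, pow_mul]; exact Nat.pow_le_pow_left (by norm_num) _
    have h5 : 0 < 2 ^ (4 * w.length) := by positivity
    rw [numer, pow_add]
    omega
  rw [numerW, binVal_addW, binVal_powBits, Bool.toNat_false, zero_add, pow_mul]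
  exact Nat.mod_eq_of_modEq ((binVal_totalW E _ w _).add_right _) h2

variable {E}

theorem QP.factor (hE : QP fun x : ℕ × List SignType => E x.1 x.2) :
    QP fun x : ℕ × List SignType × SignType => factor E x.1 x.2.1 x.2.2 := by
  have h : ∀ i : SignType, QP fun x : ℕ × List SignType × SignType => E x.1 (x.2.1 ++ [i]) :=
    fun i => hE.comp (g := fun x : ℕ × List SignType × SignType => (x.1, x.2.1 ++ [i]))
      (by fun_prop)
  have h0 := h 0
  have h1 := h 1
  have h2 := h (-1)
  unfold DisjointPairs.factor; fun_prop

theorem QP.capitalW (hE : QP fun x : ℕ × List SignType => E x.1 x.2) :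
    QP fun x : ℕ × ℕ × List SignType => capitalW E x.1 x.2.1 x.2.2 := by
  have hfac : QP fun x : (ℕ × ℕ × List SignType) × (List SignType × List Bool) × SignType =>
      DisjointPairs.factor E x.1.2.1 x.2.1.1 x.2.2 :=
    (QP.factor hE).comp (g := fun x : (ℕ × ℕ × List SignType) × (List SignType × List Bool) ×
      SignType => (x.1.2.1, x.2.1.1, x.2.2)) (by fun_prop)
  have h := foldl_of_add (α := ℕ × ℕ × List SignType) (g := fun x => x.2.2)
    (h := fun _ => ([], [true])) (f := fun x (s : List SignType × List Bool) a =>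
    (s.1 ++ [a], DisjointPairs.mulW x.1 (DisjointPairs.factor E x.2.1 s.1 a) s.2))
    (C := fun n => 2 * n + 10) (by fun_prop) (by fun_prop) (by fun_prop)
    (((QB.const 2).mul .id).add (.const 10)) fun x s a _ => by
      have h1 := sz_append s.1 [a]
      have h2 := sz_mulW_le x.1 (DisjointPairs.factor E x.2.1 s.1 a) s.2
      have h3 := sz_sign_le a
      have h4 : sz x.1 = 2 * x.1 + 1 := sz_nat _
      simp only [sz_prod x, sz_prod s, sz_mk, sz_cons, sz_nil] at *
      omega
  exact snd h

theorem QP.totalW (hE : QP fun x : ℕ × List SignType => E x.1 x.2) :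
    QP fun x : ℕ × List SignType × ℕ => totalW E x.1 x.2.1 x.2.2 := by
  have hcap : QP fun x : (ℕ × List SignType × ℕ) × (ℕ × List Bool) =>
      DisjointPairs.capitalW E x.1.1 x.2.1 x.1.2.1 :=
    (QP.capitalW hE).comp (g := fun x : (ℕ × List SignType × ℕ) × (ℕ × List Bool) =>
      (x.1.1, x.2.1, x.1.2.1)) (by fun_prop)
  have h := iterate_of_add (α := ℕ × List SignType × ℕ) (n := fun x => x.2.2)
    (h := fun _ => (0, [])) (f := fun x (s : ℕ × List Bool) => (s.1 + 1,
      DisjointPairs.addW x.1 false (DisjointPairs.addW x.1 false s.2 s.2)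
        (DisjointPairs.capitalW E x.1 s.1 x.2.1)))
    (C := fun n => 2 * n + 10) (by fun_prop) (by fun_prop) (by fun_prop)
    (((QB.const 2).mul .id).add (.const 10)) fun x s => by
      have h1 := sz_addW_le x.1 false (DisjointPairs.addW x.1 false s.2 s.2)
        (DisjointPairs.capitalW E x.1 s.1 x.2.1)
      have h4 : sz x.1 = 2 * x.1 + 1 := sz_nat _
      simp only [sz_prod x, sz_prod s, sz_mk, sz_nat] at *
      omega
  exact snd h

theorem isP2Computable_mart (hE : QP fun x : ℕ × List SignType => E x.1 x.2) :
    IsP2Computable (mart E) := by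
  have htot : QP fun w : List SignType => totalW E (4 * w.length + 4) w w.length :=
    (QP.totalW hE).comp (g := fun w : List SignType => (4 * w.length + 4, w, w.length))
      (by fun_prop)
  have hnum : QP fun w : List SignType => numerW E w := by unfold numerW; fun_prop
  have hmap : ∀ {u : List SignType → List Bool}, QP u → QP fun w => (u w).map some := fun hu =>
    QP.map (f := fun _ => some) hu ((QP.of_toT_eq (f := fun x : Unit × Bool => some x.2)
      fun _ => rfl).comp (QP.pair (.const ()) (QP.snd .id)))
  have hmn := hmap hnum
  have hmd := hmap (u := fun w => powBits (3 * w.length)) (by fun_prop)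
  have hnone : QP fun _ : List SignType => (none : Option Bool) := by fun_prop
  obtain ⟨k, hk⟩ := QP.computableInTime
    (f := fun w => joinWords (numerW E w) (powBits (3 * w.length)))
    (by unfold joinWords; fun_prop)
  refine ⟨k, _, _, hk, fun w => ?_⟩
  have h8 : binVal (powBits (3 * w.length)) = 8 ^ w.length := by
    rw [binVal_powBits, pow_mul]; norm_num
  rw [h8, binVal_numerW]
  exact ⟨by positivity, rfl⟩

end

end DisjointPairs

/-! ### The theorem -/

theorem mainTheorem5
    (h : ¬ DisjointPairs.HasMeasureZeroInDisjEXP DisjointPairs.disjNP) :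
    ∀ k : ℕ, ∃ Q ∈ DisjointPairs.disjNP,
      DisjointPairs.DisjointPair.IsGeneric (DisjointPairs.quasiPoly k) Q := by
  open DisjointPairs in
  intro k
  by_contra hk
  push Not at hk
  refine h ⟨mart fun j w => clocked k (treeOf j) w, isPairMartingale_mart _,
    isP2Computable_mart (QP.clocked k (QP.treeOf (by fun_prop)) (by fun_prop)), fun Q hQ => ?_⟩
  have hQ' := hk Q hQ.1
  simp only [DisjointPair.IsGeneric, not_forall] at hQ'
  obtain ⟨C, hC, hd, hm⟩ := hQ'
  obtain ⟨l, r, he⟩ := exists_clocked hC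
  obtain ⟨j, hj⟩ := exists_treeOf l r
  exact succeeds_mart _ (j := j) (by simpa only [hj] using he) hd hm
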